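/- Let $\Gamma$ be a convex, strictly decreasing curve in the first quadrant with intercepts $L>0$ on the $x$-axis and $M>0$ on the $y$-axis: $\Gamma$ is the graph of a continuous, convex, strictly decreasing function $f:[0,L]\to[0,M]$ with $f(0)=M$ and $f(L)=0$; let $g:[0,M]\to[0,L]$ be the inverse function of $f$. Write $\operatorname{Area}(\Gamma)$ for the area enclosed by $\Gamma$ and the coordinate axes. For $r,s>0$ let \[ N(r,s)=\#\{(j,k)\in\mathbb{N}\times\mathbb{N} : js/r\le L,\ k\le rs\,f(js/r)\},\qquad \mathbb{N}=\{1,2,3,\dots\}, \] be the number of positive-integer lattice points lying inside or on the graph of $x\mapsto rs\,f(sx/r)$, $0\le x\le rL/s$, and let \[ S(r)=\operatorname*{arg\,max}_{s>0}N(r,s) \] be the set of all $s>0$ at which $s\mapsto N(r,s)$ attains its maximum over $(0,\infty)$. Assume that there is a point $(\alpha,\beta)\in\Gamma$ with $0<\alpha<L/2$ and $0<\beta<M/2$ such that $f\in C^2[\alpha,L]$ with $f'<0$ on $[\alpha,L)$ and with $f''>0$ and $f''$ monotonic on $[\alpha,L]$, and $g\in C^2[\beta,M]$ with $g'<0$ on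 $[\beta,M)$ and with $g''>0$ and $g''$ monotonic on $[\beta,M]$ (derivatives at the endpoints are one-sided). Assume also that $L=M$. Then the optimal stretch factor for maximizing $N(r,s)$ approaches $1$ as $r\to\infty$: there is a constant $C$, depending only on $\Gamma$, such that for all sufficiently large $r$ \[ S(r)\subset\big[1-Cr^{-1/6},\,1+Cr^{-1/6}\big]. \] Moreover, $\max_{s>0}N(r,s)$ exists for every $r>0$, and, as $r\to\infty$, \[ \max_{s>0}N(r,s)=r^2\operatorname{Area}(\Gamma)-rL+O(r^{2/3}). \] -/

import Mathlib

open Set Filter Asymptotics MeasureTheory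

/-- `Γ`, the graph of `f` over `[0, L]`, is a convex, strictly decreasing curve with intercepts
`L` on the `x`-axis and `M` on the `y`-axis, and `g` on `[0, M]` is the inverse function of `f`. -/
structure IsConvexDecreasingCurve (f g : ℝ → ℝ) (L M : ℝ) : Prop where
  L_pos : 0 < L
  continuousOn : ContinuousOn f (Icc 0 L)
  convexOn : ConvexOn ℝ (Icc 0 L) f
  strictAntiOn : StrictAntiOn f (Icc 0 L)
  f_zero : f 0 = M
  f_L : f L = 0
  mapsTo_g : MapsTo g (Icc 0 M) (Icc 0 L)
  f_g : ∀ y ∈ Icc 0 M, f (g y) = y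

/-- The area enclosed by the curve and the two axes. -/
noncomputable def enclosedArea (f : ℝ → ℝ) (L : ℝ) : ℝ :=
  volume.real {p : ℝ × ℝ | 0 < p.1 ∧ p.1 < L ∧ 0 < p.2 ∧ p.2 < f p.1}

/-- The positive-integer points `(j, k)` lying inside or on the curve `rΓ(s)`, the graph of
`x ↦ r s f(s x / r)` over `0 ≤ x ≤ r L / s`. -/
def latticePoints (f : ℝ → ℝ) (L r s : ℝ) : Set (ℕ × ℕ) :=
  {p | 1 ≤ p.1 ∧ 1 ≤ p.2 ∧ (p.1 : ℝ) * s / r ≤ L ∧ (p.2 : ℝ) ≤ r * s * f ((p.1 : ℝ) * s / r)}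

/-- The counting function `N(r, s)`. -/
noncomputable def latticeCount (f : ℝ → ℝ) (L r s : ℝ) : ℕ :=
  (latticePoints f L r s).ncard

/-- `S(r)`, the set of all `s > 0` that maximize `N(r, s)` over `s > 0`. -/
def optimalStretch (f : ℝ → ℝ) (L r : ℝ) : Set ℝ :=
  {s | 0 < s ∧ ∀ t : ℝ, 0 < t → latticeCount f L r t ≤ latticeCount f L r s}

/-- The set of lattice points is finite, so that `Set.ncard` counts it. -/
theorem latticePoints_finite {f g : ℝ → ℝ} {L M r s : ℝ}
    (hΓ : IsConvexDecreasingCurve f g L M) (hr : 0 < r) (hs : 0 < s) :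
    (latticePoints f L r s).Finite := by
  refine ((finite_Iic ⌊L * r / s⌋₊).prod (finite_Iic ⌊r * s * M⌋₊)).subset ?_
  rintro ⟨j, k⟩ ⟨-, -, h1, h2⟩
  simp only at h1 h2
  have h0 : 0 ≤ (j : ℝ) * s / r := by positivity
  have hf : f ((j : ℝ) * s / r) ≤ M := by
    rw [← hΓ.f_zero]
    exact hΓ.strictAntiOn.antitoneOn ⟨le_rfl, hΓ.L_pos.le⟩ ⟨h0, h1⟩ h0
  refine ⟨Nat.le_floor ?_, Nat.le_floor ?_⟩
  · rw [le_div_iff₀ hs]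
    exact (div_le_iff₀ hr).1 h1
  · exact h2.trans (mul_le_mul_of_nonneg_left hf (by positivity))

/-! For `s` in a fixed range `[1/T, T]`, the count satisfies N(r,s) = r² Area − rL(s + 1/s)/2 +
O(r^(2/3)) uniformly (`exists_abs_latticeCount_sub_le` with `L = M`). Relative to `s = 1`, the
second term loses rL(s + 1/s − 2)/2 = rL(s − 1)²/(2s). A maximizer does at least as well as `s = 1`,
so this loss is O(r^(2/3)). Hence (s − 1)² = O(r^(-1/3)) and |s − 1| = O(r^(-1/6)). The same
comparison gives the size of the maximum.

Maximizers must first be confined to such a range. For a convex decreasing function the lower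
Riemann sum misses at least half of the total drop, which yields N(r,s) ≤ r² Area − c·r·min(s, r)
for every `s` (`exists_latticeCount_le`). Reflection in the diagonal swaps `f` with `g` and `s` with
`1/s`, so the same bound holds with `1/s`. Since N(r,1) ≥ r² Area − O(r), neither `s` nor `1/s` can
be large.

For the uniform asymptotics, the lattice points are split at (α, β) into columns to the right, rows
above and a rectangle. On each arc the second derivative lies between positive constants. Writing
⌊y⌋ = y − 1/2 − ψ(y) with ψ the sawtooth, the smooth part is summed by Euler–Maclaurin, and the sum
of ψ is O(r^(2/3)) by van der Corput's method (`exists_abs_sum_sawtooth_le`): ψ is squeezed between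
difference quotients of the periodic Bernoulli function B₂, whose Fourier series converges
absolutely, and the resulting exponential sums are bounded by the second derivative test, itself a
consequence of the Kusmin–Landau inequality. -/

/-! ### Exponential sums: Kusmin–Landau and the second derivative test. -/

/-- The additive character `x ↦ exp (2πix)` of the reals. -/
noncomputable def expTwoPiI (x : ℝ) : ℂ := Complex.exp (((2 * Real.pi * x : ℝ) : ℂ) * Complex.I)

lemma norm_expTwoPiI (x : ℝ) : ‖expTwoPiI x‖ = 1 := Complex.norm_exp_ofReal_mul_I _

lemma expTwoPiI_add (x y : ℝ) : expTwoPiI (x + y) = expTwoPiI x * expTwoPiI y := by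
  rw [expTwoPiI, expTwoPiI, expTwoPiI, ← Complex.exp_add]
  congr 1
  push_cast
  ring

lemma expTwoPiI_intCast (n : ℤ) : expTwoPiI n = 1 := by
  rw [expTwoPiI, Complex.exp_eq_one_iff]
  exact ⟨n, by push_cast; ring⟩

lemma re_expTwoPiI (x : ℝ) : (expTwoPiI x).re = Real.cos (2 * Real.pi * x) := by
  rw [expTwoPiI, Complex.exp_ofReal_mul_I_re]

lemma im_expTwoPiI (x : ℝ) : (expTwoPiI x).im = Real.sin (2 * Real.pi * x) := by
  rw [expTwoPiI, Complex.exp_ofReal_mul_I_im]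

lemma norm_expTwoPiI_sub_one_le (x : ℝ) : ‖expTwoPiI x - 1‖ ≤ 2 * Real.pi * |x| := by
  have h := Real.norm_exp_I_mul_ofReal_sub_one_le (x := 2 * Real.pi * x)
  rw [Real.norm_eq_abs, abs_mul, abs_of_pos Real.two_pi_pos] at h
  rwa [expTwoPiI, mul_comm]

/-- The real cotangent of `πx`. -/
noncomputable def cotPi (x : ℝ) : ℝ := Real.cos (Real.pi * x) / Real.sin (Real.pi * x)

lemma two_mul_le_sin_pi_mul {θ x : ℝ} (h0 : 0 ≤ θ) (h1 : θ ≤ x) (h2 : x ≤ 1 - θ) :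
    2 * θ ≤ Real.sin (Real.pi * x) := by
  have hp := Real.pi_pos
  have key : ∀ y : ℝ, θ ≤ y → y ≤ 1 / 2 → 2 * θ ≤ Real.sin (Real.pi * y) := fun y hy hy' => by
    have := Real.mul_le_sin (x := Real.pi * y) (by have := h0.trans hy; positivity)
      (by nlinarith)
    have e : 2 / Real.pi * (Real.pi * y) = 2 * y := by field_simp
    linarith
  rcases le_total x (1 / 2) with h | h
  · exact key x h1 h
  · have := key (1 - x) (by linarith) (by linarith)
    rwa [show Real.pi * (1 - x) = Real.pi - Real.pi * x by ring, Real.sin_pi_sub] at this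

lemma cotPi_le_of_le {x y : ℝ} (hx : 0 < x) (hxy : x ≤ y) (hy : y < 1) : cotPi y ≤ cotPi x := by
  have hp := Real.pi_pos
  have sx : 0 < Real.sin (Real.pi * x) := Real.sin_pos_of_pos_of_lt_pi (by positivity) (by nlinarith)
  have sy : 0 < Real.sin (Real.pi * y) :=
    Real.sin_pos_of_pos_of_lt_pi (by have := hx.trans_le hxy; positivity) (by nlinarith)
  rw [cotPi, cotPi, div_le_div_iff₀ sy sx]
  have h : 0 ≤ Real.sin (Real.pi * y - Real.pi * x) :=
    Real.sin_nonneg_of_nonneg_of_le_pi (by nlinarith) (by nlinarith)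
  rw [Real.sin_sub] at h
  linarith

lemma abs_cotPi_le {θ x : ℝ} (h0 : 0 < θ) (h1 : θ ≤ x) (h2 : x ≤ 1 - θ) :
    |cotPi x| ≤ 1 / (2 * θ) := by
  have hs := two_mul_le_sin_pi_mul h0.le h1 h2
  rw [cotPi, abs_div, abs_of_pos (a := Real.sin _) (by linarith)]
  exact div_le_div₀ zero_le_one (Real.abs_cos_le_one _) (by linarith) hs

/-- The value of `1 / (1 - exp (2πix))`. -/
noncomputable def geomCoeff (x : ℝ) : ℂ := ⟨1 / 2, cotPi x / 2⟩

lemma geomCoeff_mul {x : ℝ} (hx : Real.sin (Real.pi * x) ≠ 0) :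
    geomCoeff x * (1 - expTwoPiI x) = 1 := by
  have h1 : Real.cos (2 * Real.pi * x) = 1 - 2 * Real.sin (Real.pi * x) ^ 2 := by
    rw [mul_assoc, Real.cos_two_mul, Real.cos_sq']; ring
  have h2 : Real.sin (2 * Real.pi * x) = 2 * Real.sin (Real.pi * x) * Real.cos (Real.pi * x) := by
    rw [mul_assoc, Real.sin_two_mul]
  have h3 := Real.sin_sq_add_cos_sq (Real.pi * x)
  apply Complex.ext
  · simp only [geomCoeff, Complex.mul_re, Complex.sub_re, Complex.sub_im, Complex.one_re,
      Complex.one_im, re_expTwoPiI, im_expTwoPiI, h1, h2, cotPi]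
    field_simp
    linear_combination (2 * Real.sin (Real.pi * x)) * h3
  · simp only [geomCoeff, Complex.mul_im, Complex.sub_re, Complex.sub_im, Complex.one_re,
      Complex.one_im, re_expTwoPiI, im_expTwoPiI, h1, h2, cotPi]
    field_simp
    ring

lemma norm_geomCoeff_le {θ x : ℝ} (h0 : 0 < θ) (h1 : θ ≤ x) (h2 : x ≤ 1 - θ) :
    ‖geomCoeff x‖ ≤ 1 / (2 * θ) := by
  have h := Complex.norm_le_abs_re_add_abs_im (geomCoeff x)
  have h3 := abs_cotPi_le h0 h1 h2
  have h4 : (1 : ℝ) ≤ 1 / (2 * θ) := by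
    rw [le_div_iff₀ (by positivity)]; linarith
  simp only [geomCoeff, abs_div] at h ⊢
  norm_num at h ⊢
  norm_num at h3 h4
  linarith

/-- The real part of `geomCoeff` is constant, so its variation is that of the cotangent. The
cotangent is monotone on (0, 1), so the variation along a monotone sequence telescopes. -/
lemma norm_geomCoeff_sub (x y : ℝ) : ‖geomCoeff x - geomCoeff y‖ = |cotPi x - cotPi y| / 2 := by
  have : geomCoeff x - geomCoeff y = (((cotPi x - cotPi y) / 2 : ℝ) : ℂ) * Complex.I := by
    apply Complex.ext
    · simp [geomCoeff]
    · simp [geomCoeff]; ring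
  rw [this, norm_mul, Complex.norm_I, mul_one, Complex.norm_real, Real.norm_eq_abs, abs_div,
    abs_two]

/-- **Kusmin–Landau inequality**: an exponential sum whose phase has monotone increments staying
at distance at least `θ` from the integers is `O(1 / θ)`. -/
theorem norm_sum_expTwoPiI_le_of_increments (u : ℕ → ℝ) (n : ℕ) (ν : ℤ) {θ : ℝ} (hθ : 0 < θ)
    (h1 : ∀ k < n, ν + θ ≤ u (k + 1) - u k) (h2 : ∀ k < n, u (k + 1) - u k ≤ ν + 1 - θ)
    (hm : ∀ k, k + 1 < n → u (k + 1) - u k ≤ u (k + 2) - u (k + 1)) :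
    ‖∑ k ∈ Finset.range n, expTwoPiI (u k)‖ ≤ 2 / θ := by
  rcases n with _ | n
  · simp; positivity
  set x : ℕ → ℝ := fun k => u (k + 1) - u k - ν with hx
  have hx1 : ∀ k < n + 1, θ ≤ x k := fun k hk => by simp only [hx]; linarith [h1 k hk]
  have hx2 : ∀ k < n + 1, x k ≤ 1 - θ := fun k hk => by simp only [hx]; linarith [h2 k hk]
  -- Each term is a difference weighted by `geomCoeff (x k)`, as in summing a geometric progression;
  -- the weights vary with `k`, so summation by parts follows.
  have hE : ∀ k < n + 1,
      expTwoPiI (u k) = geomCoeff (x k) * expTwoPiI (u k) - geomCoeff (x k) * expTwoPiI (u (k + 1)) := by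
    intro k hk
    have hs := two_mul_le_sin_pi_mul hθ.le (hx1 k hk) (hx2 k hk)
    have e : expTwoPiI (u (k + 1)) = expTwoPiI (u k) * expTwoPiI (x k) := by
      rw [show u (k + 1) = u k + x k + ν by simp only [hx]; ring, expTwoPiI_add, expTwoPiI_add,
        expTwoPiI_intCast, mul_one]
    rw [e]
    linear_combination (-expTwoPiI (u k)) * geomCoeff_mul (x := x k) (by linarith)
  -- Summation by parts, done as an induction: adding the boundary term makes each step cost only
  -- |geomCoeff (x (m+1)) − geomCoeff (x m)|, which telescopes because the `x k` increase.
  have key : ∀ m, m < n + 1 → ‖∑ k ∈ Finset.range (m + 1), expTwoPiI (u k) +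
      geomCoeff (x m) * expTwoPiI (u (m + 1))‖ ≤ 1 / (2 * θ) + (cotPi (x 0) - cotPi (x m)) / 2 := by
    intro m
    induction m with
    | zero =>
      intro hm0
      have : ∑ k ∈ Finset.range (0 + 1), expTwoPiI (u k) + geomCoeff (x 0) * expTwoPiI (u (0 + 1)) =
          geomCoeff (x 0) * expTwoPiI (u 0) := by
        rw [zero_add, Finset.sum_range_one]
        linear_combination hE 0 hm0
      rw [this, norm_mul, norm_expTwoPiI, mul_one, sub_self, zero_div, add_zero]
      exact norm_geomCoeff_le hθ (hx1 0 hm0) (hx2 0 hm0)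
    | succ m ih =>
      intro hm1
      have hm0 : m < n + 1 := by omega
      have : ∑ k ∈ Finset.range (m + 1 + 1), expTwoPiI (u k) +
          geomCoeff (x (m + 1)) * expTwoPiI (u (m + 1 + 1)) =
          (∑ k ∈ Finset.range (m + 1), expTwoPiI (u k) + geomCoeff (x m) * expTwoPiI (u (m + 1))) +
            (geomCoeff (x (m + 1)) - geomCoeff (x m)) * expTwoPiI (u (m + 1)) := by
        rw [Finset.sum_range_succ]
        linear_combination hE (m + 1) hm1
      have hc : cotPi (x (m + 1)) ≤ cotPi (x m) :=
        cotPi_le_of_le (hθ.trans_le (hx1 m hm0)) (by simp only [hx]; linarith [hm m hm1])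
          (by linarith [hx2 _ hm1])
      rw [this]
      refine (norm_add_le _ _).trans ?_
      rw [norm_mul, norm_expTwoPiI, mul_one, norm_geomCoeff_sub, abs_of_nonpos (by linarith)]
      linarith [ih hm0]
  have hn : n < n + 1 := by omega
  have h0 : 0 < n + 1 := by omega
  have e : ∑ k ∈ Finset.range (n + 1), expTwoPiI (u k) =
      (∑ k ∈ Finset.range (n + 1), expTwoPiI (u k) + geomCoeff (x n) * expTwoPiI (u (n + 1))) -
        geomCoeff (x n) * expTwoPiI (u (n + 1)) := by ring
  rw [e]
  refine (norm_sub_le _ _).trans ?_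
  rw [norm_mul, norm_expTwoPiI, mul_one]
  have b1 := key n hn
  have b2 := norm_geomCoeff_le hθ (hx1 n hn) (hx2 n hn)
  have b3 := abs_le.1 (abs_cotPi_le hθ (hx1 n hn) (hx2 n hn))
  have b4 := abs_le.1 (abs_cotPi_le hθ (hx1 0 h0) (hx2 0 h0))
  have : 2 / θ = 4 * (1 / (2 * θ)) := by field_simp; norm_num
  have hpos : 0 < 1 / (2 * θ) := by positivity
  linarith [b3.1, b4.2]

/-- For a monotone sequence the indices with values in a window are consecutive, so a sum over them
is again a sum along a sequence with monotone increments. -/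
lemma exists_filter_eq_Ico {n : ℕ} {d : ℕ → ℝ} (hd : ∀ i j, i ≤ j → j < n → d i ≤ d j)
    (x y : ℝ) : ∃ p q, q ≤ n ∧
      (Finset.range n).filter (fun k => x ≤ d k ∧ d k < y) = Finset.Ico p q := by
  set s := (Finset.range n).filter (fun k => x ≤ d k ∧ d k < y) with hs
  rcases s.eq_empty_or_nonempty with h | h
  · exact ⟨0, 0, by omega, by simpa using h⟩
  · have h1 := Finset.mem_filter.1 (s.min'_mem h)
    have h2 := Finset.mem_filter.1 (s.max'_mem h)
    refine ⟨s.min' h, s.max' h + 1, Finset.mem_range.1 h2.1, ?_⟩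
    ext k
    rw [Finset.mem_Ico]
    constructor
    · intro hk
      exact ⟨s.min'_le k hk, Nat.lt_succ_of_le (s.le_max' k hk)⟩
    · rintro ⟨hk1, hk2⟩
      have hk3 : k ≤ s.max' h := by omega
      have hn := Finset.mem_range.1 h2.1
      exact Finset.mem_filter.2 ⟨Finset.mem_range.2 (by omega),
        h1.2.1.trans (hd _ _ hk1 (by omega)), (hd _ _ hk3 hn).trans_lt h2.2.2⟩

section SecondDifference

variable {n : ℕ} {u : ℕ → ℝ} {c : ℝ}

lemma mul_le_increment_sub (h1 : ∀ k, k + 1 < n → c ≤ u (k + 2) - 2 * u (k + 1) + u k)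
    (i m : ℕ) (hm : i + m < n) :
    c * m ≤ (u (i + m + 1) - u (i + m)) - (u (i + 1) - u i) := by
  induction m with
  | zero => simp
  | succ m ih =>
    have := ih (by omega)
    have := h1 (i + m) (by omega)
    push_cast
    rw [show i + (m + 1) + 1 = i + m + 2 by ring, show i + (m + 1) = i + m + 1 by ring]
    linarith

lemma increment_sub_le_mul (h2 : ∀ k, k + 1 < n → u (k + 2) - 2 * u (k + 1) + u k ≤ c)
    (i m : ℕ) (hm : i + m < n) :
    (u (i + m + 1) - u (i + m)) - (u (i + 1) - u i) ≤ c * m := by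
  induction m with
  | zero => simp
  | succ m ih =>
    have := ih (by omega)
    have := h2 (i + m) (by omega)
    push_cast
    rw [show i + (m + 1) + 1 = i + m + 2 by ring, show i + (m + 1) = i + m + 1 by ring]
    linarith

lemma increment_mono (hc : 0 ≤ c)
    (h1 : ∀ k, k + 1 < n → c ≤ u (k + 2) - 2 * u (k + 1) + u k)
    (i j : ℕ) (hij : i ≤ j) (hj : j < n) : u (i + 1) - u i ≤ u (j + 1) - u j := by
  obtain ⟨m, rfl⟩ := Nat.exists_eq_add_of_le hij
  have := mul_le_increment_sub h1 i m hj
  have : 0 ≤ c * m := by positivity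
  linarith

/-- This is the trivial bound: successive increments are at least `c` apart, so few of them fit into
a short window. -/
lemma norm_sum_filter_le_of_short (hc : 0 < c)
    (h1 : ∀ k, k + 1 < n → c ≤ u (k + 2) - 2 * u (k + 1) + u k) {x y : ℝ} (hxy : x ≤ y) :
    ‖∑ k ∈ (Finset.range n).filter (fun k => x ≤ u (k + 1) - u k ∧ u (k + 1) - u k < y),
      expTwoPiI (u k)‖ ≤ (y - x) / c + 1 := by
  obtain ⟨p, q, hq, he⟩ := exists_filter_eq_Ico (n := n) (d := fun k => u (k + 1) - u k)
    (increment_mono hc.le h1) x y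
  refine (norm_sum_le _ _).trans ?_
  simp only [norm_expTwoPiI, Finset.sum_const, nsmul_eq_mul, mul_one]
  rw [he, Nat.card_Ico]
  rcases Nat.lt_or_ge p q with hpq | hpq
  · obtain ⟨m, rfl⟩ := Nat.exists_eq_add_of_lt hpq
    have hp : p ∈ Finset.Ico p (p + m + 1) := Finset.mem_Ico.2 ⟨le_rfl, by omega⟩
    have hm : p + m ∈ Finset.Ico p (p + m + 1) := Finset.mem_Ico.2 ⟨by omega, by omega⟩
    rw [← he] at hp hm
    have hp' := (Finset.mem_filter.1 hp).2.1
    have hm' := (Finset.mem_filter.1 hm).2.2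
    have := mul_le_increment_sub h1 p m (by omega)
    rw [show p + m + 1 - p = m + 1 by omega]
    push_cast
    gcongr
    rw [le_div_iff₀ hc]
    linarith
  · rw [Nat.sub_eq_zero_of_le hpq]
    have : 0 ≤ (y - x) / c := div_nonneg (by linarith) hc.le
    push_cast
    linarith

/-- The increments in the window form a block to which Kusmin–Landau applies. -/
lemma norm_sum_filter_le_of_far (hc : 0 ≤ c)
    (h1 : ∀ k, k + 1 < n → c ≤ u (k + 2) - 2 * u (k + 1) + u k) (ν : ℤ) {θ : ℝ} (hθ : 0 < θ) :
    ‖∑ k ∈ (Finset.range n).filter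
      (fun k => ν + θ ≤ u (k + 1) - u k ∧ u (k + 1) - u k < ν + 1 - θ), expTwoPiI (u k)‖ ≤
      2 / θ := by
  obtain ⟨p, q, hq, he⟩ := exists_filter_eq_Ico (n := n) (d := fun k => u (k + 1) - u k)
    (increment_mono hc h1) (ν + θ) (ν + 1 - θ)
  rw [he, Finset.sum_Ico_eq_sum_range]
  have hmem : ∀ k < q - p, ν + θ ≤ u (p + k + 1) - u (p + k) ∧
      u (p + k + 1) - u (p + k) < ν + 1 - θ := fun k hk => by
    have : p + k ∈ Finset.Ico p q := Finset.mem_Ico.2 ⟨by omega, by omega⟩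
    rw [← he] at this
    exact (Finset.mem_filter.1 this).2
  refine norm_sum_expTwoPiI_le_of_increments (fun k => u (p + k)) (q - p) ν hθ
    (fun k hk => (hmem k hk).1) (fun k hk => (hmem k hk).2.le) (fun k hk => ?_)
  exact increment_mono hc h1 (p + k) (p + k + 1) (by omega) (by omega)

end SecondDifference

/-- **Van der Corput's second derivative test**, in terms of second differences. -/
theorem norm_sum_expTwoPiI_le_of_second_difference {A δ : ℝ} (hA : 1 ≤ A) (hδ : 0 < δ) (n : ℕ)
    (u : ℕ → ℝ) (h1 : ∀ k, k + 1 < n → δ ^ 2 ≤ u (k + 2) - 2 * u (k + 1) + u k)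
    (h2 : ∀ k, k + 1 < n → u (k + 2) - 2 * u (k + 1) + u k ≤ A * δ ^ 2) :
    ‖∑ k ∈ Finset.range (n + 1), expTwoPiI (u k)‖ ≤ 5 * A * δ * (n + 1) + 11 / δ := by
  -- For δ > 1/2 the trivial bound `n + 1` is already below the claim.
  rcases lt_or_ge (1 / 2) δ with hδ' | hδ'
  · refine (norm_sum_le _ _).trans ?_
    simp only [norm_expTwoPiI, Finset.sum_const, nsmul_eq_mul, mul_one, Finset.card_range]
    push_cast
    have : 0 < 11 / δ := by positivity
    have h3 : 1 ≤ 5 * A * δ := by nlinarith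
    have h4 : (0 : ℝ) ≤ n := n.cast_nonneg
    nlinarith
  have hδi : 2 ≤ 1 / δ := by rw [le_div_iff₀ hδ]; linarith
  have hc : 0 < δ ^ 2 := by positivity
  set d : ℕ → ℝ := fun k => u (k + 1) - u k with hd
  -- Increments between ν and ν + 1: the two windows of length δ next to the integers contribute at
  -- most 1/δ + 1 each, the middle at most 2/δ. The total 4/δ + 2 is at most 5/δ because 1/δ ≥ 2.
  have fiber : ∀ ν : ℤ, ‖∑ k ∈ (Finset.range n).filter (fun k => ⌊d k⌋ = ν), expTwoPiI (u k)‖ ≤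
      5 / δ := by
    intro ν
    have e : (Finset.range n).filter (fun k => ⌊d k⌋ = ν) =
        ((Finset.range n).filter (fun k => (ν : ℝ) ≤ d k ∧ d k < ν + δ) ∪
        (Finset.range n).filter (fun k => ν + δ ≤ d k ∧ d k < ν + 1 - δ)) ∪
        (Finset.range n).filter (fun k => ν + 1 - δ ≤ d k ∧ d k < ν + 1) := by
      ext k
      simp only [Finset.mem_union, Finset.mem_filter, ← and_or_left, Int.floor_eq_iff]
      refine and_congr_right fun _ => ⟨fun h => ?_, ?_⟩
      · by_cases h3 : d k < ν + δ
        · exact Or.inl (Or.inl ⟨h.1, h3⟩)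
        · by_cases h4 : d k < ν + 1 - δ
          · exact Or.inl (Or.inr ⟨not_lt.1 h3, h4⟩)
          · exact Or.inr ⟨not_lt.1 h4, h.2⟩
      · rintro ((h | h) | h) <;> constructor <;> linarith [h.1, h.2]
    rw [e, Finset.sum_union, Finset.sum_union]
    · have b1 := norm_sum_filter_le_of_short hc h1 (x := ν) (y := ν + δ) (by linarith)
      have b2 := norm_sum_filter_le_of_far hc.le h1 ν hδ
      have b3 := norm_sum_filter_le_of_short hc h1 (x := ν + 1 - δ) (y := ν + 1) (by linarith)
      have e1 : (ν + δ - ν) / δ ^ 2 = 1 / δ := by field_simp; ring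
      have e2 : (ν + 1 - (ν + 1 - δ)) / δ ^ 2 = 1 / δ := by field_simp; ring
      rw [e1] at b1
      rw [e2] at b3
      have e3 : 2 / δ = 2 * (1 / δ) := by ring
      have e5 : 5 / δ = 5 * (1 / δ) := by ring
      refine (norm_add_le _ _).trans ?_
      refine (add_le_add_left (norm_add_le _ _) _).trans ?_
      linarith
    · rw [Finset.disjoint_filter]
      rintro k - h3 h4
      linarith [h3.2, h4.1]
    · rw [← Finset.filter_or, Finset.disjoint_filter]
      rintro k - (h3 | h3) h4 <;> linarith [h3.2, h4.1]
  -- The increments grow by at most Aδ²n in total, so at most Aδ²n + 2 integers ν occur as floors.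
  -- The last term `k = n` has no increment in range and is added separately.
  have main : ‖∑ k ∈ Finset.range n, expTwoPiI (u k)‖ ≤ (A * δ ^ 2 * n + 2) * (5 / δ) := by
    rcases Nat.eq_zero_or_pos n with rfl | hn
    · simp; positivity
    have hmaps : ∀ k ∈ Finset.range n, ⌊d k⌋ ∈ Finset.Icc ⌊d 0⌋ ⌊d (n - 1)⌋ := fun k hk => by
      have hk := Finset.mem_range.1 hk
      exact Finset.mem_Icc.2 ⟨Int.floor_mono (increment_mono hc.le h1 0 k (by omega) hk),
        Int.floor_mono (increment_mono hc.le h1 k (n - 1) (by omega) (by omega))⟩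
    rw [← Finset.sum_fiberwise_of_maps_to hmaps]
    refine (norm_sum_le _ _).trans ((Finset.sum_le_sum fun ν _ => fiber ν).trans ?_)
    rw [Finset.sum_const, nsmul_eq_mul]
    gcongr
    have hle : ⌊d 0⌋ ≤ ⌊d (n - 1)⌋ :=
      Int.floor_mono (increment_mono hc.le h1 0 (n - 1) (by omega) (by omega))
    have hcard : ((Finset.Icc ⌊d 0⌋ ⌊d (n - 1)⌋).card : ℝ) = ⌊d (n - 1)⌋ + 1 - ⌊d 0⌋ := by
      have := Int.card_Icc_of_le ⌊d 0⌋ ⌊d (n - 1)⌋ (by omega)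
      exact_mod_cast this
    rw [hcard]
    have b1 := increment_sub_le_mul h2 0 (n - 1) (by omega)
    have b2 := Int.floor_le (d (n - 1))
    have b3 := Int.sub_one_lt_floor (d 0)
    rw [zero_add] at b1
    have b4 : ((n - 1 : ℕ) : ℝ) ≤ n := by exact_mod_cast Nat.sub_le n 1
    have b5 : A * δ ^ 2 * ((n - 1 : ℕ) : ℝ) ≤ A * δ ^ 2 * n := by gcongr
    simp only [hd] at b2 b3 ⊢
    linarith
  rw [Finset.sum_range_succ]
  refine (norm_add_le _ _).trans ?_
  rw [norm_expTwoPiI]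
  have e : (A * δ ^ 2 * n + 2) * (5 / δ) = 5 * A * δ * n + 10 * (1 / δ) := by field_simp; ring
  have e2 : 11 / δ = 11 * (1 / δ) := by ring
  have : 0 ≤ 5 * A * δ := by positivity
  rw [e] at main
  linarith

/-! ### Sawtooth sums: smoothing, Fourier expansion and van der Corput's bound. -/

/-- The sawtooth function. -/
noncomputable def sawtooth (x : ℝ) : ℝ := Int.fract x - 1 / 2

lemma abs_sawtooth_le (x : ℝ) : |sawtooth x| ≤ 1 / 2 := by
  rw [sawtooth, abs_le]
  constructor <;> linarith [Int.fract_nonneg x, Int.fract_lt_one x]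

/-- The second Bernoulli function, extended periodically. -/
noncomputable def periodicBernoulli (x : ℝ) : ℝ := Int.fract x ^ 2 - Int.fract x + 1 / 6

/-- The sawtooth ψ has slope 1 and only downward jumps, so ψ(x) ≤ ψ(x − τ) + τ for 0 ≤ τ ≤ δ.
Averaging over τ gives the claim, since 2ψ is the derivative of `periodicBernoulli` away from the
integers. -/
lemma sawtooth_le {δ : ℝ} (h0 : 0 < δ) (h1 : δ ≤ 1) (x : ℝ) :
    sawtooth x ≤ δ + (periodicBernoulli x - periodicBernoulli (x + -δ)) / (2 * δ) := by
  have e : ∀ t : ℝ, (t : ℝ) = t * (2 * δ) / (2 * δ) := fun t => by field_simp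
  rw [← sub_le_iff_le_add', e (sawtooth x - δ)]
  gcongr
  have hx := Int.fract_nonneg x
  have hx' := Int.fract_lt_one x
  rcases le_or_gt δ (Int.fract x) with h | h
  · have : Int.fract (x + -δ) = Int.fract x - δ := by
      rw [Int.fract_eq_iff]
      exact ⟨by linarith, by linarith, ⌊x⌋, by rw [Int.fract]; ring⟩
    rw [sawtooth, periodicBernoulli, periodicBernoulli, this]
    nlinarith
  · have : Int.fract (x + -δ) = Int.fract x - δ + 1 := by
      rw [Int.fract_eq_iff]
      exact ⟨by linarith, by linarith, ⌊x⌋ - 1, by rw [Int.fract]; push_cast; ring⟩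
    rw [sawtooth, periodicBernoulli, periodicBernoulli, this]
    nlinarith

/-- The mirror image of `sawtooth_le`: ψ(x) ≥ ψ(x + τ) − τ, averaged over 0 ≤ τ ≤ δ. -/
lemma le_sawtooth {δ : ℝ} (h0 : 0 < δ) (h1 : δ ≤ 1) (x : ℝ) :
    -δ - (periodicBernoulli x - periodicBernoulli (x + δ)) / (2 * δ) ≤ sawtooth x := by
  have e : ∀ t : ℝ, (t : ℝ) = t * (2 * δ) / (2 * δ) := fun t => by field_simp
  suffices h : (-sawtooth x - δ) ≤
      (periodicBernoulli x - periodicBernoulli (x + δ)) / (2 * δ) by linarith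
  rw [e (-sawtooth x - δ)]
  gcongr
  have hx := Int.fract_nonneg x
  have hx' := Int.fract_lt_one x
  rcases lt_or_ge (Int.fract x + δ) 1 with h | h
  · have : Int.fract (x + δ) = Int.fract x + δ := by
      rw [Int.fract_eq_iff]
      exact ⟨by linarith, by linarith, ⌊x⌋, by rw [Int.fract]; ring⟩
    rw [sawtooth, periodicBernoulli, periodicBernoulli, this]
    nlinarith
  · have : Int.fract (x + δ) = Int.fract x + δ - 1 := by
      rw [Int.fract_eq_iff]
      exact ⟨by linarith, by linarith, ⌊x⌋ + 1, by rw [Int.fract]; push_cast; ring⟩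
    rw [sawtooth, periodicBernoulli, periodicBernoulli, this]
    nlinarith

lemma hasSum_cos_periodicBernoulli (x : ℝ) :
    HasSum (fun h : ℕ => 1 / (h : ℝ) ^ 2 * Real.cos (2 * Real.pi * (h * x)))
      (Real.pi ^ 2 * periodicBernoulli x) := by
  have H := hasSum_one_div_nat_pow_mul_cos (k := 1) one_ne_zero
    (x := Int.fract x) ⟨Int.fract_nonneg x, (Int.fract_lt_one x).le⟩
  convert H using 1
  · funext h
    rw [mul_one]
    congr 1
    have : 2 * Real.pi * (h * x) =
        2 * Real.pi * h * Int.fract x + ((h * ⌊x⌋ : ℤ) : ℝ) * (2 * Real.pi) := by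
      rw [Int.fract]; push_cast; ring
    rw [this, Real.cos_add_int_mul_two_pi]
  · have : (Polynomial.map (algebraMap ℚ ℝ) (Polynomial.bernoulli (2 * 1))).eval (Int.fract x) =
        periodicBernoulli x := by
      rw [mul_one, Polynomial.bernoulli]
      simp [Finset.sum_range_succ, bernoulli_two, periodicBernoulli, bernoulli_one,
        Polynomial.eval_add]
      ring
    rw [this]
    norm_num [Nat.factorial]
    left
    ring

lemma re_expTwoPiI_sub (x y : ℝ) :
    Real.cos (2 * Real.pi * x) - Real.cos (2 * Real.pi * (x + y)) =
      ((1 - expTwoPiI y) * expTwoPiI x).re := by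
  rw [← re_expTwoPiI, ← re_expTwoPiI, expTwoPiI_add, ← Complex.sub_re]
  congr 1
  ring

/-- Expanding in Fourier series turns the shift by `t` into the factor 1 − e(ht) on frequency `h`.
The minimum bounds that factor, trivially or by its smallness for small `h|t|`. The hypothesis
bounds all partial sums, so no summability of the bounds is needed. -/
lemma abs_sum_periodicBernoulli_le (n : ℕ) (u : ℕ → ℝ) (t B : ℝ)
    (hB : ∀ N : ℕ, ∑ h ∈ Finset.range N, 1 / ((h : ℝ) + 1) ^ 2 *
      (min 2 (2 * Real.pi * ((h + 1) * |t|)) *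
        ‖∑ k ∈ Finset.range n, expTwoPiI ((h + 1) * u k)‖) ≤ B) :
    |∑ k ∈ Finset.range n, (periodicBernoulli (u k) - periodicBernoulli (u k + t))| ≤
      B / Real.pi ^ 2 := by
  have hp : |Real.pi ^ 2| = Real.pi ^ 2 := abs_of_pos (by positivity)
  rw [le_div_iff₀ (by positivity), ← hp, ← abs_mul]
  have H : HasSum (fun h : ℕ => ∑ k ∈ Finset.range n,
      (1 / (h : ℝ) ^ 2 * Real.cos (2 * Real.pi * (h * u k)) -
        1 / (h : ℝ) ^ 2 * Real.cos (2 * Real.pi * (h * (u k + t)))))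
      ((∑ k ∈ Finset.range n, (periodicBernoulli (u k) - periodicBernoulli (u k + t))) *
        Real.pi ^ 2) := by
    rw [Finset.sum_mul]
    refine hasSum_sum fun k _ => ?_
    rw [mul_comm (_ - _), mul_sub]
    exact (hasSum_cos_periodicBernoulli _).sub (hasSum_cos_periodicBernoulli _)
  refine le_of_tendsto ((tendsto_add_atTop_iff_nat 1).2 H.tendsto_sum_nat).abs
    (Eventually.of_forall fun N => ?_)
  refine (Finset.abs_sum_le_sum_abs _ _).trans (le_trans ?_ (hB N))
  -- The frequency-zero term is split off; it vanishes because 1 / 0² = 0 by convention.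
  rw [Finset.sum_range_succ']
  simp only [Nat.cast_zero, ne_eq, OfNat.ofNat_ne_zero, not_false_eq_true, zero_pow, div_zero,
    zero_mul, sub_self, Finset.sum_const_zero, abs_zero, add_zero]
  refine Finset.sum_le_sum fun h _ => ?_
  push_cast
  have e : ∑ k ∈ Finset.range n,
      (1 / ((h : ℝ) + 1) ^ 2 * Real.cos (2 * Real.pi * ((h + 1) * u k)) -
        1 / ((h : ℝ) + 1) ^ 2 * Real.cos (2 * Real.pi * ((h + 1) * (u k + t)))) =
      1 / ((h : ℝ) + 1) ^ 2 * ((1 - expTwoPiI ((h + 1) * t)) *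
        ∑ k ∈ Finset.range n, expTwoPiI ((h + 1) * u k)).re := by
    rw [Finset.mul_sum, Complex.re_sum, Finset.mul_sum]
    refine Finset.sum_congr rfl fun k _ => ?_
    rw [← mul_sub, mul_add, re_expTwoPiI_sub]
  rw [e, abs_mul, abs_of_nonneg (a := 1 / ((h : ℝ) + 1) ^ 2) (by positivity)]
  gcongr
  refine (Complex.abs_re_le_norm _).trans ?_
  rw [norm_mul]
  gcongr
  refine le_min ?_ ?_
  · refine (norm_sub_le _ _).trans ?_
    rw [norm_one, norm_expTwoPiI]
    norm_num
  · rw [norm_sub_rev]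
    refine (norm_expTwoPiI_sub_one_le _).trans_eq ?_
    rw [abs_mul, abs_of_nonneg (a := (h : ℝ) + 1) (by positivity)]

lemma inv_sqrt_add_one_le {x : ℝ} (hx : 0 ≤ x) : 1 / √(x + 1) ≤ 2 * (√(x + 1) - √x) := by
  have ha : 0 < √(x + 1) := Real.sqrt_pos.2 (by linarith)
  rw [div_le_iff₀ ha]
  nlinarith [Real.mul_self_sqrt hx, Real.mul_self_sqrt (show 0 ≤ x + 1 by linarith),
    sq_nonneg (√(x + 1) - √x)]

lemma inv_mul_sqrt_add_one_le {x : ℝ} (hx : 0 < x) :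
    1 / ((x + 1) * √(x + 1)) ≤ 2 / √x - 2 / √(x + 1) := by
  have ha : 0 < √(x + 1) := Real.sqrt_pos.2 (by linarith)
  have hb : 0 < √x := Real.sqrt_pos.2 hx
  have ha2 := Real.mul_self_sqrt (show 0 ≤ x + 1 by linarith)
  have hb2 := Real.mul_self_sqrt hx.le
  have hab : √x ≤ √(x + 1) := Real.sqrt_le_sqrt (by linarith)
  rw [div_sub_div _ _ hb.ne' ha.ne', div_le_div_iff₀ (by positivity) (by positivity)]
  set a := √(x + 1)
  set b := √x
  rw [← ha2]
  have h1 : b * (a + b) ≤ 2 * a ^ 2 * ((a - b) * (a + b)) := by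
    have : (a - b) * (a + b) = 1 := by linear_combination ha2 - hb2
    rw [this]
    nlinarith
  have h2 : b ≤ 2 * a ^ 2 * (a - b) := by
    refine le_of_mul_le_mul_right ?_ (show 0 < a + b by positivity)
    linarith
  nlinarith [mul_le_mul_of_nonneg_right h2 ha.le]

lemma sum_min_div_le_head {H : ℕ} (hH : 1 ≤ H) (N : ℕ) :
    ∑ h ∈ Finset.range N, min 1 (((h : ℝ) + 1) / H) / (((h : ℝ) + 1) * √((h : ℝ) + 1)) ≤
      2 * √N / H := by
  have hH0 : (0 : ℝ) < H := by exact_mod_cast hH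
  induction N with
  | zero => simp
  | succ N ih =>
    rw [Finset.sum_range_succ]
    have hN : (0 : ℝ) < (N : ℝ) + 1 := by positivity
    have h1 : min 1 (((N : ℝ) + 1) / H) / (((N : ℝ) + 1) * √((N : ℝ) + 1)) ≤
        2 * (√((N : ℝ) + 1) - √N) / H := by
      calc _ ≤ (((N : ℝ) + 1) / H) / (((N : ℝ) + 1) * √((N : ℝ) + 1)) := by
            gcongr
            exact min_le_right _ _
        _ = 1 / √((N : ℝ) + 1) / H := by
            have := Real.sqrt_pos.2 hN
            field_simp
        _ ≤ _ := by
            gcongr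
            exact inv_sqrt_add_one_le N.cast_nonneg
    push_cast
    have : 2 * √((N : ℝ) + 1) / H = 2 * √(N : ℝ) / H + 2 * (√((N : ℝ) + 1) - √N) / H := by ring
    linarith

/-- The sum is split at `H`. Below, the minimum is bounded by (h+1)/H, leaving a sum of
(h+1)^(-1/2); above, by 1, leaving a tail of (h+1)^(-3/2). Both are compared with telescoping
differences, and each contributes 2/√H. -/
lemma sum_min_div_le {H : ℕ} (hH : 1 ≤ H) (N : ℕ) :
    ∑ h ∈ Finset.range N, min 1 (((h : ℝ) + 1) / H) / (((h : ℝ) + 1) * √((h : ℝ) + 1)) ≤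
      4 / √H := by
  have hH0 : (0 : ℝ) < H := by exact_mod_cast hH
  have hs : 0 < √(H : ℝ) := Real.sqrt_pos.2 hH0
  have hsq : √(H : ℝ) * √(H : ℝ) = H := Real.mul_self_sqrt hH0.le
  have e : 2 * √(H : ℝ) / H = 2 / √H := by
    rw [div_eq_div_iff hH0.ne' hs.ne', mul_assoc, hsq]
  have e4 : 4 / √(H : ℝ) = 2 / √(H : ℝ) + 2 / √(H : ℝ) := by ring
  have tail : ∀ m : ℕ, ∑ h ∈ Finset.range (H + m), min 1 (((h : ℝ) + 1) / H) /
      (((h : ℝ) + 1) * √((h : ℝ) + 1)) ≤ 4 / √H - 2 / √((H + m : ℕ) : ℝ) := by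
    intro m
    induction m with
    | zero =>
      have := sum_min_div_le_head hH H
      rw [e] at this
      simp only [add_zero]
      linarith
    | succ m ih =>
      rw [← add_assoc, Finset.sum_range_succ]
      have h1 : min 1 ((((H + m : ℕ) : ℝ) + 1) / H) /
          ((((H + m : ℕ) : ℝ) + 1) * √(((H + m : ℕ) : ℝ) + 1)) ≤
          2 / √((H + m : ℕ) : ℝ) - 2 / √(((H + m : ℕ) : ℝ) + 1) := by
        refine le_trans ?_ (inv_mul_sqrt_add_one_le (by exact_mod_cast (by omega)))
        gcongr
        exact min_le_left _ _
      push_cast at *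
      linarith
  rcases le_total N H with h | h
  · refine (sum_min_div_le_head hH N).trans ?_
    have h1 : 2 * √(N : ℝ) / H ≤ 2 * √(H : ℝ) / H := by gcongr
    have : 0 < 2 / √(H : ℝ) := by positivity
    linarith
  · obtain ⟨m, rfl⟩ := Nat.exists_eq_add_of_le h
    have := tail m
    have : 0 ≤ 2 / √((H + m : ℕ) : ℝ) := by positivity
    linarith

/-- Smoothing at scale 1/H costs (n + 1)/H. At frequency `h` the second differences are multiplied
by `h`, so the second derivative test applies with √h·δ in place of δ, and the weights make the sum
over `h` converge. -/
lemma abs_sum_sawtooth_le {A δ : ℝ} (hA : 1 ≤ A) (hδ : 0 < δ) {H : ℕ} (hH : 1 ≤ H) (n : ℕ)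
    (u : ℕ → ℝ) (h1 : ∀ k, k + 1 < n → δ ^ 2 ≤ u (k + 2) - 2 * u (k + 1) + u k)
    (h2 : ∀ k, k + 1 < n → u (k + 2) - 2 * u (k + 1) + u k ≤ A * δ ^ 2) :
    |∑ k ∈ Finset.range (n + 1), sawtooth (u k)| ≤
      (n + 1) / H + 20 * A * δ * (n + 1) * √H + 44 / δ := by
  have hH0 : (0 : ℝ) < H := by exact_mod_cast hH
  have hp := Real.pi_pos
  have hd0 : 0 < 1 / (H : ℝ) := by positivity
  have hd1 : 1 / (H : ℝ) ≤ 1 := by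
    rw [div_le_one hH0]; exact_mod_cast hH
  have hs : 0 < √(H : ℝ) := Real.sqrt_pos.2 hH0
  have hsq : √(H : ℝ) * √(H : ℝ) = H := Real.mul_self_sqrt hH0.le
  set B : ℝ := 2 * Real.pi * (20 * A * δ * (n + 1) / √H + 44 / (δ * H)) with hBdef
  have hB : ∀ t : ℝ, |t| = 1 / H → ∀ N : ℕ, ∑ h ∈ Finset.range N, 1 / ((h : ℝ) + 1) ^ 2 *
      (min 2 (2 * Real.pi * ((h + 1) * |t|)) *
        ‖∑ k ∈ Finset.range (n + 1), expTwoPiI ((h + 1) * u k)‖) ≤ B := by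
    intro t ht N
    -- The first part of the test's bound keeps the minimum; in the second it is replaced by its
    -- upper bound (h+1)/H. The factor with `(1 : ℕ)` equals 1 and is there so that `sum_min_div_le`
    -- with `H = 1` sums the second part.
    have term : ∀ h ∈ Finset.range N, 1 / ((h : ℝ) + 1) ^ 2 *
        (min 2 (2 * Real.pi * ((h + 1) * |t|)) *
          ‖∑ k ∈ Finset.range (n + 1), expTwoPiI ((h + 1) * u k)‖) ≤
        2 * Real.pi * (5 * A * δ * (n + 1) *
          (min 1 (((h : ℝ) + 1) / H) / (((h : ℝ) + 1) * √((h : ℝ) + 1))) +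
          11 / (δ * H) * (min 1 (((h : ℝ) + 1) / (1 : ℕ)) /
            (((h : ℝ) + 1) * √((h : ℝ) + 1)))) := by
      intro h _
      set x : ℝ := (h : ℝ) + 1 with hx
      have hx1 : 1 ≤ x := by simp [hx]
      have hx0 : 0 < x := by linarith
      have hr : 0 < √x := Real.sqrt_pos.2 hx0
      have hr2 : √x * √x = x := Real.mul_self_sqrt hx0.le
      have hS := norm_sum_expTwoPiI_le_of_second_difference hA (mul_pos hr hδ) n
        (fun k => x * u k) (fun k hk => by
          have := mul_le_mul_of_nonneg_left (h1 k hk) hx0.le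
          rw [mul_pow, sq √x, hr2]; linarith) (fun k hk => by
          have := mul_le_mul_of_nonneg_left (h2 k hk) hx0.le
          rw [mul_pow, sq √x, hr2]; linarith)
      have hm1 : min 2 (2 * Real.pi * (x * |t|)) ≤ 2 * Real.pi * min 1 (x / H) := by
        rw [ht, mul_one_div]
        refine le_trans (min_le_min_right _ (?_ : (2 : ℝ) ≤ 2 * Real.pi * 1)) ?_
        · linarith [Real.pi_gt_three]
        · rw [← mul_min_of_nonneg _ _ (by positivity)]
      have hm2 : min 1 (x / H) ≤ x / H := min_le_right _ _
      have hm0 : 0 ≤ min 1 (x / H) := by positivity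
      have hm3 : min 1 (x / ((1 : ℕ) : ℝ)) = 1 := by
        rw [Nat.cast_one, div_one]; exact min_eq_left hx1
      rw [hm3]
      calc _ ≤ 1 / x ^ 2 * (2 * Real.pi * min 1 (x / H) *
            (5 * A * (√x * δ) * (n + 1) + 11 / (√x * δ))) := by gcongr
        _ = 2 * Real.pi * (5 * A * δ * (n + 1) * (min 1 (x / H) * √x / x ^ 2) +
            11 / δ * (1 / (x ^ 2 * √x)) * min 1 (x / H)) := by
            field_simp
        _ ≤ 2 * Real.pi * (5 * A * δ * (n + 1) * (min 1 (x / H) * √x / x ^ 2) +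
            11 / δ * (1 / (x ^ 2 * √x)) * (x / H)) := by gcongr
        _ = _ := by
            have : x ^ 2 = x * √x * √x := by rw [mul_assoc, hr2, sq]
            congr 2
            · rw [this]; field_simp
            · field_simp
    refine (Finset.sum_le_sum term).trans ?_
    rw [← Finset.mul_sum, Finset.sum_add_distrib, ← Finset.mul_sum, ← Finset.mul_sum]
    have s1 := sum_min_div_le hH N
    have s2 := sum_min_div_le le_rfl N
    rw [hBdef]
    gcongr ?_ * (?_ + ?_)
    · calc _ ≤ 5 * A * δ * (n + 1) * (4 / √H) := by gcongr
        _ = _ := by ring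
    · calc _ ≤ 11 / (δ * H) * (4 / √((1 : ℕ) : ℝ)) := by gcongr
        _ = _ := by rw [Nat.cast_one, Real.sqrt_one]; ring
  have hBH : B / Real.pi ^ 2 / (2 * (1 / H)) ≤ 20 * A * δ * (n + 1) * √H + 44 / δ := by
    have : B / Real.pi ^ 2 / (2 * (1 / H)) =
        (20 * A * δ * (n + 1) * √H + 44 / δ) / Real.pi := by
      have e : 20 * A * δ * (n + 1) / √H = 20 * A * δ * (n + 1) * √H / H := by
        rw [div_eq_div_iff hs.ne' hH0.ne', mul_assoc _ (√(H : ℝ)), hsq]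
      rw [hBdef, e]
      field_simp
    rw [this]
    exact div_le_self (by positivity) (by linarith [Real.pi_gt_three])
  have conv : ∀ t : ℝ, |t| = 1 / H →
      |(∑ k ∈ Finset.range (n + 1), (periodicBernoulli (u k) - periodicBernoulli (u k + t))) /
        (2 * (1 / H))| ≤ 20 * A * δ * (n + 1) * √H + 44 / δ := by
    intro t ht
    rw [abs_div, abs_of_pos (a := 2 * (1 / (H : ℝ))) (by positivity)]
    refine le_trans ?_ hBH
    gcongr
    exact abs_sum_periodicBernoulli_le _ _ _ _ (hB t ht)
  have c1 := conv (1 / H) (abs_of_pos hd0)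
  have c2 := conv (-(1 / H)) (by rw [abs_neg]; exact abs_of_pos hd0)
  have l1 := Finset.sum_le_sum fun k (_ : k ∈ Finset.range (n + 1)) => le_sawtooth hd0 hd1 (u k)
  have l2 := Finset.sum_le_sum fun k (_ : k ∈ Finset.range (n + 1)) => sawtooth_le hd0 hd1 (u k)
  rw [Finset.sum_sub_distrib, ← Finset.sum_div, Finset.sum_const, Finset.card_range,
    nsmul_eq_mul] at l1
  rw [Finset.sum_add_distrib, Finset.sum_const, Finset.card_range, nsmul_eq_mul,
    ← Finset.sum_div] at l2
  push_cast at l1 l2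
  have e1 : ((n : ℝ) + 1) * (1 / H) = (n + 1) / H := by ring
  have e2 : ((n : ℝ) + 1) * -(1 / H) = -((n + 1) / H) := by ring
  rw [e2] at l1
  rw [e1] at l2
  rw [abs_le] at c1 c2 ⊢
  constructor <;> linarith [c1.1, c1.2, c2.1, c2.2]

/-- **Van der Corput's bound** for sawtooth sums along a sequence whose second differences are
comparable with `1 / R`. -/
theorem exists_abs_sum_sawtooth_le (c₁ c₂ c₃ : ℝ) (hc₁ : 0 < c₁) :
    ∃ C : ℝ, ∀ (R : ℝ) (n : ℕ) (u : ℕ → ℝ), 1 ≤ R → n ≤ c₃ * R →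
      (∀ k, k + 2 < n → c₁ / R ≤ u (k + 2) - 2 * u (k + 1) + u k) →
      (∀ k, k + 2 < n → u (k + 2) - 2 * u (k + 1) + u k ≤ c₂ / R) →
      |∑ k ∈ Finset.range n, sawtooth (u k)| ≤ C * R ^ (2 / 3 : ℝ) := by
  set A : ℝ := max 1 (c₂ / c₁) with hA
  refine ⟨|c₃| + 40 * A * √c₁ * |c₃| + 44 / √c₁, fun R n u hR hn h1 h2 => ?_⟩
  have hR0 : 0 < R := by linarith
  have hs : 0 < √c₁ := Real.sqrt_pos.2 hc₁
  have hA1 : 1 ≤ A := le_max_left _ _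
  rcases n with _ | n
  · simp; positivity
  -- In powers of ρ: n ≪ ρ⁶ and δ = √c₁/ρ³. Taking H = ⌈ρ²⌉ balances n/H against nδ√H, both of order
  -- ρ⁴ = R^(2/3); the remaining 44/δ is only of order ρ³.
  set ρ : ℝ := R ^ (1 / 6 : ℝ) with hρ
  have hρ1 : 1 ≤ ρ := Real.one_le_rpow hR (by norm_num)
  have hρ0 : 0 < ρ := by linarith
  have e6 : ρ ^ 6 = R := by
    rw [hρ, ← Real.rpow_natCast, ← Real.rpow_mul hR0.le]; norm_num
  have e4 : R ^ (2 / 3 : ℝ) = ρ ^ 4 := by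
    rw [hρ, ← Real.rpow_natCast, ← Real.rpow_mul hR0.le]; norm_num
  have hδ : (√c₁ / ρ ^ 3) ^ 2 = c₁ / R := by
    rw [div_pow, Real.sq_sqrt hc₁.le, ← e6]; ring
  have hc2 : c₂ ≤ A * c₁ := by
    rw [← div_le_iff₀ hc₁]; exact le_max_right _ _
  have hH1 : 1 ≤ ⌈ρ ^ 2⌉₊ := Nat.one_le_ceil_iff.2 (by positivity)
  have hHl : ρ ^ 2 ≤ ⌈ρ ^ 2⌉₊ := Nat.le_ceil _
  have hHu : (⌈ρ ^ 2⌉₊ : ℝ) ≤ (2 * ρ) ^ 2 := by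
    have := Nat.ceil_lt_add_one (show 0 ≤ ρ ^ 2 by positivity)
    nlinarith
  have key := abs_sum_sawtooth_le hA1 (δ := √c₁ / ρ ^ 3) (by positivity) hH1 n u
    (fun k hk => by rw [hδ]; exact h1 k (by omega))
    (fun k hk => by
      rw [hδ, ← mul_div_assoc]
      exact (h2 k (by omega)).trans (by gcongr))
  have hsq : √(⌈ρ ^ 2⌉₊ : ℝ) ≤ 2 * ρ := Real.sqrt_le_iff.2 ⟨by positivity, hHu⟩
  have hn' : (n : ℝ) + 1 ≤ |c₃| * ρ ^ 6 := by
    rw [e6]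
    push_cast at hn
    exact hn.trans (by gcongr; exact le_abs_self _)
  rw [e4]
  refine key.trans ?_
  have b1 : ((n : ℝ) + 1) / ⌈ρ ^ 2⌉₊ ≤ |c₃| * ρ ^ 4 := by
    calc ((n : ℝ) + 1) / ⌈ρ ^ 2⌉₊ ≤ |c₃| * ρ ^ 6 / ρ ^ 2 := by gcongr
      _ = _ := by field_simp
  have b2 : 20 * A * (√c₁ / ρ ^ 3) * (n + 1) * √(⌈ρ ^ 2⌉₊ : ℝ) ≤
      40 * A * √c₁ * |c₃| * ρ ^ 4 := by
    calc _ ≤ 20 * A * (√c₁ / ρ ^ 3) * (|c₃| * ρ ^ 6) * (2 * ρ) := by gcongr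
      _ = _ := by field_simp; ring
  have b3 : 44 / (√c₁ / ρ ^ 3) ≤ 44 / √c₁ * ρ ^ 4 := by
    calc 44 / (√c₁ / ρ ^ 3) = 44 / √c₁ * ρ ^ 3 := by field_simp
      _ ≤ _ := by
        gcongr ?_ * ?_
        exact pow_le_pow_right₀ hρ1 (by norm_num)
  linarith

/-! ### Curvature bounds, Euler–Maclaurin summation and the count under one arc. -/

/-- The deviation of `f` from its chords on `[a, b]` is comparable with that of a parabola, as is
the case if `m ≤ f'' ≤ K`. -/
structure HasCurvatureBounds (f : ℝ → ℝ) (a b m K : ℝ) : Prop where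
  le_chord : ∀ x ∈ Icc a b, ∀ y ∈ Icc a b, ∀ t ∈ Icc (0 : ℝ) 1,
    m / 2 * (t * (1 - t)) * (y - x) ^ 2 ≤ (1 - t) * f x + t * f y - f ((1 - t) * x + t * y)
  chord_le : ∀ x ∈ Icc a b, ∀ y ∈ Icc a b, ∀ t ∈ Icc (0 : ℝ) 1,
    (1 - t) * f x + t * f y - f ((1 - t) * x + t * y) ≤ K / 2 * (t * (1 - t)) * (y - x) ^ 2

lemma HasCurvatureBounds.of_convexOn {f : ℝ → ℝ} {a b m K : ℝ}
    (h1 : ConvexOn ℝ (Icc a b) fun x => f x - m / 2 * x ^ 2)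
    (h2 : ConvexOn ℝ (Icc a b) fun x => K / 2 * x ^ 2 - f x) : HasCurvatureBounds f a b m K := by
  constructor
  · intro x hx y hy t ht
    have := h1.2 hx hy (show 0 ≤ 1 - t by linarith [ht.2]) ht.1 (by ring)
    simp only [smul_eq_mul] at this
    linarith
  · intro x hx y hy t ht
    have := h2.2 hx hy (show 0 ≤ 1 - t by linarith [ht.2]) ht.1 (by ring)
    simp only [smul_eq_mul] at this
    linarith

lemma HasCurvatureBounds.second_difference {f : ℝ → ℝ} {a b m K : ℝ}
    (hf : HasCurvatureBounds f a b m K) {x h : ℝ} (hx : x ∈ Icc a b) (hy : x + 2 * h ∈ Icc a b) :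
    m * h ^ 2 ≤ f (x + 2 * h) - 2 * f (x + h) + f x ∧
      f (x + 2 * h) - 2 * f (x + h) + f x ≤ K * h ^ 2 := by
  have ht : (1 / 2 : ℝ) ∈ Icc (0 : ℝ) 1 := by constructor <;> norm_num
  have h1 := hf.le_chord x hx _ hy _ ht
  have h2 := hf.chord_le x hx _ hy _ ht
  rw [show (1 - 1 / 2) * x + 1 / 2 * (x + 2 * h) = x + h by ring] at h1 h2
  constructor <;> nlinarith

/-- A `C²` function with positive second derivative on a compact interval has positive curvature
bounds. -/
lemma exists_hasCurvatureBounds {f : ℝ → ℝ} {a b : ℝ} (hab : a < b)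
    (hf : ContDiffOn ℝ 2 f (Icc a b))
    (hf2 : ∀ x ∈ Icc a b, 0 < iteratedDerivWithin 2 f (Icc a b) x) :
    ∃ m K : ℝ, 0 < m ∧ 0 ≤ K ∧ HasCurvatureBounds f a b m K := by
  have hu : UniqueDiffOn ℝ (Icc a b) := uniqueDiffOn_Icc hab
  have hc := hf.continuousOn_iteratedDerivWithin (m := 2) le_rfl hu
  have hne : (Icc a b).Nonempty := nonempty_Icc.2 hab.le
  obtain ⟨x₀, hx₀, hmin⟩ := isCompact_Icc.exists_isMinOn hne hc
  obtain ⟨x₁, hx₁, hmax⟩ := isCompact_Icc.exists_isMaxOn hne hc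
  -- With `m` and `K` the minimum and maximum of f'', both f − mx²/2 and Kx²/2 − f have nonnegative
  -- second derivative, hence are convex.
  refine ⟨iteratedDerivWithin 2 f (Icc a b) x₀, iteratedDerivWithin 2 f (Icc a b) x₁, hf2 _ hx₀,
    (hf2 _ hx₁).le, ?_⟩
  have d1 : ∀ x ∈ interior (Icc a b),
      HasDerivWithinAt f (derivWithin f (Icc a b) x) (interior (Icc a b)) x := fun x hx =>
    ((hf.differentiableOn (by norm_num) x (interior_subset hx)).hasDerivWithinAt).mono
      interior_subset
  have d2 : ∀ x ∈ interior (Icc a b), HasDerivWithinAt (derivWithin f (Icc a b))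
      (iteratedDerivWithin 2 f (Icc a b) x) (interior (Icc a b)) x := fun x hx => by
    have hd := hf.differentiableOn_iteratedDerivWithin (m := 1) (by norm_num) hu x
      (interior_subset hx)
    rw [iteratedDerivWithin_succ]
    rw [iteratedDerivWithin_one] at hd ⊢
    exact hd.hasDerivWithinAt.mono interior_subset
  have q1 : ∀ (c x : ℝ), HasDerivWithinAt (fun x => c / 2 * x ^ 2) (c * x)
      (interior (Icc a b)) x := fun c x => by
    have h := ((hasDerivAt_pow 2 x).const_mul (c / 2)).hasDerivWithinAt (s := interior (Icc a b))
    rwa [show c / 2 * (((2 : ℕ) : ℝ) * x ^ (2 - 1)) = c * x by push_cast; ring] at h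
  have q2 : ∀ (c x : ℝ), HasDerivWithinAt (fun x => c * x) c (interior (Icc a b)) x := fun c x => by
    simpa using ((hasDerivAt_id x).const_mul c).hasDerivWithinAt
  apply HasCurvatureBounds.of_convexOn
  · refine convexOn_of_hasDerivWithinAt2_nonneg (convex_Icc a b)
      (hf.continuousOn.sub (by fun_prop)) (fun x hx => (d1 x hx).sub (q1 _ x))
      (fun x hx => (d2 x hx).sub (q2 _ x)) fun x hx => ?_
    exact sub_nonneg.2 (hmin (interior_subset hx))
  · refine convexOn_of_hasDerivWithinAt2_nonneg (convex_Icc a b)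
      (ContinuousOn.sub (by fun_prop) hf.continuousOn) (fun x hx => (q1 _ x).sub (d1 x hx))
      (fun x hx => (q2 _ x).sub (d2 x hx)) fun x hx => ?_
    exact sub_nonneg.2 (hmax (interior_subset hx))

lemma abs_integral_sub_trapezoid_le {F : ℝ → ℝ} {x κ : ℝ} (hF : ContinuousOn F (Icc x (x + 1)))
    (hκ : ∀ t ∈ Icc (0 : ℝ) 1, |F (x + t) - ((1 - t) * F x + t * F (x + 1))| ≤ κ) :
    |(∫ y in x..x + 1, F y) - (F x + F (x + 1)) / 2| ≤ κ := by
  have hi : IntervalIntegrable F volume x (x + 1) :=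
    (hF.mono (by rw [uIcc_of_le (by linarith)])).intervalIntegrable
  have e : (F x + F (x + 1)) / 2 = ∫ y in x..x + 1, (F x + (y - x) * (F (x + 1) - F x)) := by
    rw [intervalIntegral.integral_add (by simp) (by
      apply Continuous.intervalIntegrable; fun_prop), intervalIntegral.integral_mul_const,
      intervalIntegral.integral_sub (by simp) (by simp)]
    simp
    ring
  rw [e, ← intervalIntegral.integral_sub hi (by apply Continuous.intervalIntegrable; fun_prop)]
  have := intervalIntegral.norm_integral_le_of_norm_le_const (a := x) (b := x + 1) (C := κ)
    (f := fun y => F y - (F x + (y - x) * (F (x + 1) - F x))) fun y hy => by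
      rw [uIoc_of_le (by linarith)] at hy
      have := hκ (y - x) ⟨by linarith [hy.1], by linarith [hy.2]⟩
      rw [add_sub_cancel] at this
      rw [Real.norm_eq_abs]
      convert this using 2
      ring
  simpa using this

lemma abs_sum_sub_trapezoid_le {F : ℝ → ℝ} {κ : ℝ} (p m : ℕ)
    (hF : ContinuousOn F (Icc (p : ℝ) (p + m)))
    (hκ : ∀ x : ℝ, p ≤ x → x + 1 ≤ p + m → ∀ t ∈ Icc (0 : ℝ) 1,
      |F (x + t) - ((1 - t) * F x + t * F (x + 1))| ≤ κ) :
    |∑ j ∈ Finset.range (m + 1), F (p + j) -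
      ((∫ y in (p : ℝ)..p + m, F y) + (F p + F (p + m)) / 2)| ≤ κ * m := by
  induction m with
  | zero => simp
  | succ m ih =>
    have ih := ih (hF.mono (Icc_subset_Icc_right (by push_cast; linarith)))
      (fun x h1 h2 => hκ x h1 (by push_cast; linarith))
    push_cast at hF hκ
    have hm : (0 : ℝ) ≤ m := m.cast_nonneg
    have h1 := abs_integral_sub_trapezoid_le (F := F) (x := p + m) (κ := κ)
      (hF.mono (Icc_subset_Icc (by linarith) (by linarith))) (hκ _ (by linarith) (by linarith))
    have hi1 : IntervalIntegrable F volume p (p + m) :=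
      (hF.mono (by rw [uIcc_of_le (by linarith)]; exact Icc_subset_Icc_right (by linarith))).intervalIntegrable
    have hi2 : IntervalIntegrable F volume (p + m) (p + m + 1) :=
      (hF.mono (by
        rw [uIcc_of_le (by linarith)]
        exact Icc_subset_Icc (by linarith) (by linarith))).intervalIntegrable
    rw [Finset.sum_range_succ]
    push_cast
    rw [← add_assoc, ← intervalIntegral.integral_add_adjacent_intervals hi1 hi2]
    rw [abs_le] at *
    constructor <;> linarith [ih.1, ih.2, h1.1, h1.2]

/-- A first-order **Euler–Maclaurin** formula for a function vanishing at the right endpoint. -/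
lemma abs_sum_sub_integral_le {F : ℝ → ℝ} {a b Λ κ : ℝ} (ha : 0 ≤ a) (hab : a ≤ b) (hb : F b = 0)
    (hκ0 : 0 ≤ κ) (hF : ContinuousOn F (Icc a b))
    (hΛ : ∀ x ∈ Icc a b, ∀ y ∈ Icc a b, |F x - F y| ≤ Λ * |x - y|)
    (hκ : ∀ x : ℝ, a ≤ x → x + 1 ≤ b → ∀ t ∈ Icc (0 : ℝ) 1,
      |F (x + t) - ((1 - t) * F x + t * F (x + 1))| ≤ κ) :
    |∑ j ∈ Finset.Ioc ⌊a⌋₊ ⌊b⌋₊, F j - ((∫ x in a..b, F x) + sawtooth a * F a)| ≤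
      3 * |Λ| + κ * (b - a) := by
  have hint : ∀ x y, a ≤ x → x ≤ y → y ≤ b → IntervalIntegrable F volume x y := fun x y h1 h2 h3 =>
    (hF.mono (by rw [uIcc_of_le h2]; exact Icc_subset_Icc h1 h3)).intervalIntegrable
  have fa1 := Nat.floor_le ha
  have fa2 := Nat.lt_floor_add_one a
  have fb1 := Nat.floor_le (ha.trans hab)
  have fb2 := Nat.lt_floor_add_one b
  have near : ∀ x ∈ Icc a b, ∀ y ∈ Icc a b, |x - y| ≤ 1 → |F x - F y| ≤ |Λ| :=
    fun x hx y hy h => (hΛ x hx y hy).trans (by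
      calc Λ * |x - y| ≤ |Λ| * 1 := by
            gcongr
            exact le_abs_self _
        _ = _ := mul_one _)
  have hκb : 0 ≤ κ * (b - a) := mul_nonneg hκ0 (by linarith)
  have hΛ0 := abs_nonneg Λ
  rcases lt_or_ge ⌊a⌋₊ ⌊b⌋₊ with h | h
  -- Some integer lies in (a, b]. The trapezoidal rule covers the span from the first such integer
  -- `p` to the last, `p + m`; the end pieces have length at most 1 and are handled by the Lipschitz
  -- bound.
  · obtain ⟨m, hm⟩ := Nat.exists_eq_add_of_lt h
    have hm' : (⌊b⌋₊ : ℝ) = ⌊a⌋₊ + m + 1 := by exact_mod_cast hm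
    have e : ∑ j ∈ Finset.Ioc ⌊a⌋₊ ⌊b⌋₊, F j =
        ∑ j ∈ Finset.range (m + 1), F (((⌊a⌋₊ + 1 : ℕ) : ℝ) + j) := by
      have : Finset.Ioc ⌊a⌋₊ ⌊b⌋₊ = Finset.Ico (⌊a⌋₊ + 1) (⌊b⌋₊ + 1) := by
        ext; simp
      rw [this, Finset.sum_Ico_eq_sum_range, hm,
        show ⌊a⌋₊ + m + 1 + 1 - (⌊a⌋₊ + 1) = m + 1 by omega]
      push_cast
      rfl
    set p : ℕ := ⌊a⌋₊ + 1 with hp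
    have hpc : (p : ℝ) = ⌊a⌋₊ + 1 := by simp [hp]
    have hm0 : (0 : ℝ) ≤ m := m.cast_nonneg
    have hq : (p : ℝ) + m ≤ b := by linarith
    have hap : a ≤ p := by linarith
    have t1 := abs_sum_sub_trapezoid_le p m (hF.mono (Icc_subset_Icc hap hq))
      (fun x h1 h2 => hκ x (by linarith) (by linarith))
    have hpm : κ * m ≤ κ * (b - a) := by gcongr; linarith
    have i1 : |(∫ x in a..p, F x) - (p - a) * F a| ≤ |Λ| := by
      have e1 : (p - a) * F a = ∫ _ in a..(p : ℝ), F a := by simp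
      rw [e1, ← intervalIntegral.integral_sub (hint _ _ le_rfl hap (by linarith)) (by simp)]
      have := intervalIntegral.norm_integral_le_of_norm_le_const (a := a) (b := p) (C := |Λ|)
        (f := fun y => F y - F a) fun y hy => by
          rw [uIoc_of_le hap] at hy
          exact near y ⟨hy.1.le, by linarith [hy.2]⟩ a ⟨le_rfl, hab⟩
            (by rw [abs_le]; constructor <;> linarith [hy.1, hy.2])
      refine this.trans ?_
      exact mul_le_of_le_one_right hΛ0 (by rw [abs_le]; constructor <;> linarith)
    have i2 : |∫ x in (p + m : ℝ)..b, F x| ≤ |Λ| := by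
      have := intervalIntegral.norm_integral_le_of_norm_le_const (a := p + m) (b := b) (C := |Λ|)
        (f := F) fun y hy => by
          rw [uIoc_of_le hq] at hy
          have := near y ⟨by linarith [hy.1], hy.2⟩ b ⟨hab, le_rfl⟩
            (by rw [abs_le]; constructor <;> linarith [hy.1, hy.2])
          rwa [hb, sub_zero] at this
      refine this.trans ?_
      exact mul_le_of_le_one_right hΛ0 (by rw [abs_le]; constructor <;> linarith)
    have n1 := near p ⟨hap, by linarith⟩ a ⟨le_rfl, hab⟩
      (by rw [abs_le]; constructor <;> linarith)
    have n2 := near (p + m) ⟨by linarith, hq⟩ b ⟨hab, le_rfl⟩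
      (by rw [abs_le]; constructor <;> linarith)
    rw [hb, sub_zero] at n2
    -- The trapezoidal end term F(p)/2 minus the integral over [a, p] is, up to O(Λ), (1/2 − (p −
    -- a))·F(a), which is the sawtooth term.
    have hs : sawtooth a = 1 / 2 - (p - a) := by
      rw [sawtooth, hpc, Int.fract, ← natCast_floor_eq_intCast_floor ha]; ring
    rw [e, ← intervalIntegral.integral_add_adjacent_intervals
      (hint a p le_rfl hap (by linarith)) (hint p b hap (by linarith) le_rfl),
      ← intervalIntegral.integral_add_adjacent_intervals
      (hint p (p + m) hap (by linarith) hq) (hint (p + m) b (by linarith) hq le_rfl), hs]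
    rw [abs_le] at *
    constructor <;> linarith [t1.1, t1.2, i1.1, i1.2, i2.1, i2.2, n1.1, n1.2, n2.1, n2.2]
  · have hc : (⌊b⌋₊ : ℝ) ≤ ⌊a⌋₊ := by exact_mod_cast h
    rw [Finset.Ioc_eq_empty_of_le h, Finset.sum_empty]
    have hF1 : ∀ x ∈ Icc a b, |F x| ≤ |Λ| := fun x hx => by
      have := near x hx b ⟨hab, le_rfl⟩
        (by rw [abs_le]; constructor <;> linarith [hx.1, hx.2])
      rwa [hb, sub_zero] at this
    have i2 : |∫ x in a..b, F x| ≤ |Λ| := by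
      have := intervalIntegral.norm_integral_le_of_norm_le_const (a := a) (b := b) (C := |Λ|)
        (f := F) fun y hy => by
          rw [uIoc_of_le hab] at hy
          exact hF1 y ⟨hy.1.le, hy.2⟩
      refine this.trans ?_
      exact mul_le_of_le_one_right hΛ0 (by rw [abs_le]; constructor <;> linarith)
    have i3 : |sawtooth a * F a| ≤ 1 / 2 * |Λ| := by
      rw [abs_mul]
      exact mul_le_mul (abs_sawtooth_le a) (hF1 a ⟨le_rfl, hab⟩) (abs_nonneg _) (by norm_num)
    rw [abs_le] at *
    constructor <;> linarith [i2.1, i2.2, i3.1, i3.2]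

/-- The number of lattice points under the arc of `rΓ(s)` to the right of `rα/s`. -/
lemma exists_abs_arc_count_sub_le {f : ℝ → ℝ} {α L m K Λ T : ℝ} (hα : 0 < α) (hαL : α < L)
    (hm : 0 < m) (hK : 0 ≤ K) (hf : ContinuousOn f (Icc α L)) (hfL : f L = 0)
    (hf0 : ∀ x ∈ Icc α L, 0 ≤ f x) (hc : HasCurvatureBounds f α L m K)
    (hΛ : ∀ x ∈ Icc α L, ∀ y ∈ Icc α L, |f x - f y| ≤ Λ * |x - y|) (hT : 1 ≤ T) :
    ∃ C : ℝ, ∀ r s : ℝ, 1 ≤ r → 1 / T ≤ s → s ≤ T →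
      |∑ j ∈ Finset.Ioc ⌊r * α / s⌋₊ ⌊r * L / s⌋₊, (⌊r * s * f (j * s / r)⌋₊ : ℝ) -
        (r ^ 2 * (∫ x in α..L, f x) + r * s * f α * sawtooth (r * α / s) -
          r * (L - α) / s / 2)| ≤ C * r ^ (2 / 3 : ℝ) := by
  have hT0 : 0 < T := by linarith
  -- The function x ↦ r·s·f(xs/r) has second differences between ms³/r and Ks³/r, and at most rL/s
  -- terms occur; 1/T ≤ s ≤ T makes these bounds uniform.
  obtain ⟨C₁, hC₁⟩ := exists_abs_sum_sawtooth_le (m / T ^ 3) (K * T ^ 3) (T * L)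
    (by positivity)
  refine ⟨C₁ + (3 * (|Λ| * T ^ 2) + K * T ^ 2 * (L - α)) + 1 / 2, fun r s hr hs1 hs2 => ?_⟩
  have hr0 : 0 < r := by linarith
  have hs0 : 0 < s := (by positivity : 0 < 1 / T).trans_le hs1
  have hTs : 1 ≤ T * s := by rwa [div_le_iff₀' hT0] at hs1
  have hL : 0 < L := hα.trans hαL
  set a := r * α / s with ha
  set b := r * L / s with hb
  have ha0 : 0 ≤ a := by positivity
  have hab : a ≤ b := by rw [ha, hb]; gcongr
  set F : ℝ → ℝ := fun x => r * s * f (x * s / r) with hFd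
  have hmem : ∀ x ∈ Icc a b, x * s / r ∈ Icc α L := fun x hx => by
    have h1 := hx.1
    have h2 := hx.2
    rw [ha, div_le_iff₀ hs0] at h1
    rw [hb, le_div_iff₀ hs0] at h2
    exact ⟨by rw [le_div_iff₀ hr0]; linarith, by rw [div_le_iff₀ hr0]; linarith⟩
  have ea : a * s / r = α := by rw [ha]; field_simp
  have eb : b * s / r = L := by rw [hb]; field_simp
  have hs2' : s ^ 2 ≤ T ^ 2 := by gcongr
  have hs3 : s ^ 3 ≤ T ^ 3 := by gcongr
  have hρ : 1 ≤ r ^ (2 / 3 : ℝ) := Real.one_le_rpow hr (by norm_num)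
  have em : |∑ j ∈ Finset.Ioc ⌊a⌋₊ ⌊b⌋₊, F j - ((∫ x in a..b, F x) + sawtooth a * F a)| ≤
      3 * (|Λ| * T ^ 2) + K * T ^ 2 * (L - α) := by
    have := abs_sum_sub_integral_le (F := F) (a := a) (b := b) (Λ := Λ * s ^ 2)
      (κ := K * s ^ 3 / r) ha0 hab
      (by simp only [hFd]; rw [eb, hfL, mul_zero]) (by positivity)
      (continuousOn_const.mul (hf.comp (by fun_prop) hmem))
      (fun x hx y hy => by
        simp only [hFd]
        rw [← mul_sub, abs_mul, abs_of_pos (mul_pos hr0 hs0)]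
        have h1 := mul_le_mul_of_nonneg_left (hΛ _ (hmem x hx) _ (hmem y hy))
          (mul_pos hr0 hs0).le
        refine h1.trans_eq ?_
        rw [show x * s / r - y * s / r = (x - y) * (s / r) by ring, abs_mul,
          abs_of_pos (div_pos hs0 hr0)]
        field_simp)
      (fun x hx1 hx2 t ht => by
        have k1 := hmem x ⟨hx1, by linarith⟩
        have k2 := hmem (x + 1) ⟨by linarith, hx2⟩
        have c1 := hc.le_chord _ k1 _ k2 t ht
        have c2 := hc.chord_le _ k1 _ k2 t ht
        rw [show (1 - t) * (x * s / r) + t * ((x + 1) * s / r) = (x + t) * s / r by ring,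
          show (x + 1) * s / r - x * s / r = s / r by ring] at c1 c2
        have ht4 : t * (1 - t) ≤ 1 := by nlinarith [ht.1, ht.2]
        have ht0 : 0 ≤ t * (1 - t) := mul_nonneg ht.1 (by linarith [ht.2])
        have c3 : K / 2 * (t * (1 - t)) * (s / r) ^ 2 ≤ K * 1 * (s / r) ^ 2 := by
          gcongr
          linarith
        have c4 : 0 ≤ m / 2 * (t * (1 - t)) * (s / r) ^ 2 := by positivity
        have e : F (x + t) - ((1 - t) * F x + t * F (x + 1)) = -(r * s *
            ((1 - t) * f (x * s / r) + t * f ((x + 1) * s / r) - f ((x + t) * s / r))) := by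
          simp only [hFd]; ring
        rw [e, abs_neg, abs_mul, abs_of_pos (mul_pos hr0 hs0), abs_of_nonneg (by linarith)]
        calc _ ≤ r * s * (K * 1 * (s / r) ^ 2) := by gcongr; linarith
          _ = _ := by field_simp)
    refine this.trans ?_
    have e1 : K * s ^ 3 / r * (b - a) = K * s ^ 2 * (L - α) := by
      rw [ha, hb]; field_simp
    rw [e1, abs_mul, abs_of_pos (a := s ^ 2) (by positivity)]
    gcongr
  have hint : (∫ x in a..b, F x) = r ^ 2 * ∫ x in α..L, f x := by
    simp only [hFd]
    rw [intervalIntegral.integral_const_mul]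
    have := intervalIntegral.integral_comp_mul_right (a := a) (b := b) f
      (div_pos hs0 hr0).ne'
    simp only [← mul_div_assoc] at this
    rw [this, ea, eb, smul_eq_mul]
    field_simp
  have hFa : F a = r * s * f α := by simp only [hFd]; rw [ea]
  -- The constant −1/2 sums to the boundary term −r(L − α)/(2s) up to O(1); the sawtooth is left to
  -- van der Corput's bound.
  have hfl : ∀ j ∈ Finset.Ioc ⌊a⌋₊ ⌊b⌋₊,
      (⌊r * s * f (j * s / r)⌋₊ : ℝ) = F j - 1 / 2 - sawtooth (F j) := fun j hj => by
    have hj := Finset.mem_Ioc.1 hj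
    have h1 : a < j := (Nat.floor_lt ha0).1 hj.1
    have h2 : (j : ℝ) ≤ b := (Nat.le_floor_iff (ha0.trans hab)).1 hj.2
    have : 0 ≤ r * s * f (j * s / r) :=
      mul_nonneg (mul_pos hr0 hs0).le (hf0 _ (hmem _ ⟨h1.le, h2⟩))
    rw [natCast_floor_eq_intCast_floor this, sawtooth, Int.fract]
    ring
  have hfloor : ⌊a⌋₊ ≤ ⌊b⌋₊ := Nat.floor_mono hab
  have hψ : |∑ j ∈ Finset.Ioc ⌊a⌋₊ ⌊b⌋₊, sawtooth (F j)| ≤ C₁ * r ^ (2 / 3 : ℝ) := by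
    have e : ∑ j ∈ Finset.Ioc ⌊a⌋₊ ⌊b⌋₊, sawtooth (F j) =
        ∑ k ∈ Finset.range (⌊b⌋₊ - ⌊a⌋₊), sawtooth (F ((⌊a⌋₊ : ℝ) + 1 + k)) := by
      have : Finset.Ioc ⌊a⌋₊ ⌊b⌋₊ = Finset.Ico (⌊a⌋₊ + 1) (⌊b⌋₊ + 1) := by
        ext; simp
      rw [this, Finset.sum_Ico_eq_sum_range,
        show ⌊b⌋₊ + 1 - (⌊a⌋₊ + 1) = ⌊b⌋₊ - ⌊a⌋₊ by omega]
      push_cast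
      rfl
    rw [e]
    have sd : ∀ k, k + 2 < ⌊b⌋₊ - ⌊a⌋₊ →
        m * s ^ 3 / r ≤ F ((⌊a⌋₊ : ℝ) + 1 + (k + 2 : ℕ)) - 2 * F ((⌊a⌋₊ : ℝ) + 1 + (k + 1 : ℕ)) +
          F ((⌊a⌋₊ : ℝ) + 1 + k) ∧
        F ((⌊a⌋₊ : ℝ) + 1 + (k + 2 : ℕ)) - 2 * F ((⌊a⌋₊ : ℝ) + 1 + (k + 1 : ℕ)) +
          F ((⌊a⌋₊ : ℝ) + 1 + k) ≤ K * s ^ 3 / r := by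
      intro k hk
      have hk' : (⌊a⌋₊ : ℝ) + 1 + k + 2 ≤ ⌊b⌋₊ := by
        have : ⌊a⌋₊ + 1 + k + 2 ≤ ⌊b⌋₊ := by omega
        exact_mod_cast this
      have hb1 := Nat.floor_le (ha0.trans hab)
      have ha1 := Nat.lt_floor_add_one a
      have hk0 : (0 : ℝ) ≤ k := k.cast_nonneg
      set x : ℝ := (⌊a⌋₊ : ℝ) + 1 + k with hx
      have k1 := hmem x ⟨by linarith, by linarith⟩
      have k2 := hmem (x + 2) ⟨by linarith, by linarith⟩
      rw [show (x + 2) * s / r = x * s / r + 2 * (s / r) by ring] at k2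
      have := hc.second_difference k1 k2
      push_cast
      rw [show (⌊a⌋₊ : ℝ) + 1 + (k + 2) = x + 2 by rw [hx]; ring,
        show (⌊a⌋₊ : ℝ) + 1 + (k + 1) = x + 1 by rw [hx]; ring]
      simp only [hFd]
      rw [show (x + 2) * s / r = x * s / r + 2 * (s / r) by ring,
        show (x + 1) * s / r = x * s / r + s / r by ring]
      have t1 := mul_le_mul_of_nonneg_left this.1 (mul_pos hr0 hs0).le
      have t2 := mul_le_mul_of_nonneg_left this.2 (mul_pos hr0 hs0).le
      have e1 : ∀ c : ℝ, r * s * (c * (s / r) ^ 2) = c * s ^ 3 / r := fun c => by field_simp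
      rw [e1] at t1 t2
      constructor <;> linarith
    refine hC₁ r _ (fun k => F ((⌊a⌋₊ : ℝ) + 1 + k)) hr ?_ (fun k hk => ?_) (fun k hk => ?_)
    · have h1 : ((⌊b⌋₊ - ⌊a⌋₊ : ℕ) : ℝ) ≤ ⌊b⌋₊ := by exact_mod_cast Nat.sub_le _ _
      refine h1.trans ((Nat.floor_le (ha0.trans hab)).trans ?_)
      rw [hb, div_le_iff₀ hs0]
      nlinarith [mul_pos hr0 hL]
    · refine le_trans ?_ (sd k hk).1
      gcongr
      rw [div_le_iff₀ (by positivity), mul_assoc, ← mul_pow, mul_comm s]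
      nlinarith [one_le_pow₀ hTs (n := 3)]
    · refine (sd k hk).2.trans ?_
      gcongr
  rw [Finset.sum_congr rfl hfl, Finset.sum_sub_distrib, Finset.sum_sub_distrib, Finset.sum_const,
    Nat.card_Ioc, nsmul_eq_mul, Nat.cast_sub hfloor]
  rw [hint, hFa] at em
  have e2 : r * (L - α) / s = b - a := by rw [ha, hb]; ring
  rw [e2]
  have f1 := Nat.floor_le ha0
  have f2 := Nat.lt_floor_add_one a
  have f3 := Nat.floor_le (ha0.trans hab)
  have f4 := Nat.lt_floor_add_one b
  have hX : 0 ≤ 3 * (|Λ| * T ^ 2) + K * T ^ 2 * (L - α) + 1 / 2 := by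
    have : 0 ≤ L - α := by linarith
    positivity
  have hX' := le_mul_of_one_le_right hX hρ
  rw [abs_le] at *
  constructor <;> linarith [em.1, em.2, hψ.1, hψ.2]

/-! ### Geometry of the curve: reflection, splitting of the lattice points and of the area. -/

namespace IsConvexDecreasingCurve

variable {f g : ℝ → ℝ} {L M : ℝ}

lemma M_pos (hΓ : IsConvexDecreasingCurve f g L M) : 0 < M := by
  have := hΓ.strictAntiOn ⟨le_rfl, hΓ.L_pos.le⟩ ⟨hΓ.L_pos.le, le_rfl⟩ hΓ.L_pos
  rwa [hΓ.f_L, hΓ.f_zero] at this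

lemma mapsTo_f (hΓ : IsConvexDecreasingCurve f g L M) : MapsTo f (Icc 0 L) (Icc 0 M) := by
  intro x hx
  constructor
  · rw [← hΓ.f_L]
    exact hΓ.strictAntiOn.antitoneOn hx ⟨hΓ.L_pos.le, le_rfl⟩ hx.2
  · rw [← hΓ.f_zero]
    exact hΓ.strictAntiOn.antitoneOn ⟨le_rfl, hΓ.L_pos.le⟩ hx hx.1

lemma g_f (hΓ : IsConvexDecreasingCurve f g L M) {x : ℝ} (hx : x ∈ Icc 0 L) : g (f x) = x :=
  hΓ.strictAntiOn.injOn (hΓ.mapsTo_g (hΓ.mapsTo_f hx)) hx (hΓ.f_g _ (hΓ.mapsTo_f hx))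

lemma strictAntiOn_g (hΓ : IsConvexDecreasingCurve f g L M) : StrictAntiOn g (Icc 0 M) := by
  intro y hy z hz hyz
  by_contra! h
  have := hΓ.strictAntiOn.antitoneOn (hΓ.mapsTo_g hy) (hΓ.mapsTo_g hz) h
  rw [hΓ.f_g y hy, hΓ.f_g z hz] at this
  linarith

/-- The reflection of the curve in the diagonal. -/
lemma symm (hΓ : IsConvexDecreasingCurve f g L M) : IsConvexDecreasingCurve g f M L where
  L_pos := hΓ.M_pos
  continuousOn := by
    rw [continuousOn_iff_isClosed]
    intro C hC
    -- The preimage of a closed set under `g` is its image under `f`, which is compact.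
    refine ⟨f '' (C ∩ Icc 0 L), ((isCompact_Icc.inter_left hC).image_of_continuousOn
      (hΓ.continuousOn.mono inter_subset_right)).isClosed, ?_⟩
    ext y
    constructor
    · rintro ⟨h1, h2⟩
      exact ⟨⟨g y, ⟨h1, hΓ.mapsTo_g h2⟩, hΓ.f_g y h2⟩, h2⟩
    · rintro ⟨⟨x, hx, rfl⟩, h2⟩
      refine ⟨?_, h2⟩
      rw [mem_preimage, hΓ.g_f hx.2]
      exact hx.1
  convexOn := by
    refine ⟨convex_Icc 0 M, fun y hy z hz a b ha hb hab => ?_⟩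
    have hx : a • g y + b • g z ∈ Icc 0 L :=
      convex_Icc 0 L (hΓ.mapsTo_g hy) (hΓ.mapsTo_g hz) ha hb hab
    have h := hΓ.convexOn.2 (hΓ.mapsTo_g hy) (hΓ.mapsTo_g hz) ha hb hab
    rw [hΓ.f_g y hy, hΓ.f_g z hz] at h
    -- Applying the decreasing `g` to the convexity inequality of `f` at `g y` and `g z` reverses it
    -- into convexity of `g`.
    have := hΓ.strictAntiOn_g.antitoneOn (hΓ.mapsTo_f hx) (convex_Icc 0 M hy hz ha hb hab) h
    rwa [hΓ.g_f hx] at this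
  strictAntiOn := hΓ.strictAntiOn_g
  f_zero := by rw [← hΓ.f_L]; exact hΓ.g_f ⟨hΓ.L_pos.le, le_rfl⟩
  f_L := by rw [← hΓ.f_zero]; exact hΓ.g_f ⟨le_rfl, hΓ.L_pos.le⟩
  mapsTo_g := hΓ.mapsTo_f
  f_g := fun _ hx => hΓ.g_f hx

lemma le_of_le_f (hΓ : IsConvexDecreasingCurve f g L M) {x y : ℝ} (hx : 0 ≤ x) (hy : 0 ≤ y)
    (h : x ≤ L ∧ y ≤ f x) : y ≤ M ∧ x ≤ g y := by
  have hx' : x ∈ Icc 0 L := ⟨hx, h.1⟩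
  have hy' : y ∈ Icc 0 M := ⟨hy, h.2.trans (hΓ.mapsTo_f hx').2⟩
  refine ⟨hy'.2, ?_⟩
  have := hΓ.strictAntiOn_g.antitoneOn hy' (hΓ.mapsTo_f hx') h.2
  rwa [hΓ.g_f hx'] at this

lemma le_f_iff (hΓ : IsConvexDecreasingCurve f g L M) {x y : ℝ} (hx : 0 ≤ x) (hy : 0 ≤ y) :
    (x ≤ L ∧ y ≤ f x) ↔ (y ≤ M ∧ x ≤ g y) :=
  ⟨hΓ.le_of_le_f hx hy, hΓ.symm.le_of_le_f hy hx⟩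

/-- Exchanging the axes turns the stretch `s` into `1/s`; this transfers every statement about large
`s` to small `s`. -/
lemma mem_latticePoints_iff_swap (hΓ : IsConvexDecreasingCurve f g L M) {r s : ℝ} (hr : 0 < r)
    (hs : 0 < s) (p : ℕ × ℕ) : p ∈ latticePoints f L r s ↔ p.swap ∈ latticePoints g M r s⁻¹ := by
  obtain ⟨j, k⟩ := p
  simp only [latticePoints, mem_ofPred_eq, Prod.swap]
  have h := hΓ.le_f_iff (x := j * s / r) (y := k * s⁻¹ / r) (by positivity) (by positivity)
  have e1 : (k : ℝ) * s⁻¹ / r ≤ f (j * s / r) ↔ (k : ℝ) ≤ r * s * f (j * s / r) := by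
    rw [← div_eq_mul_inv, div_div, div_le_iff₀ (by positivity)]
    ring_nf
  have e2 : (j : ℝ) * s / r ≤ g (k * s⁻¹ / r) ↔ (j : ℝ) ≤ r * s⁻¹ * g (k * s⁻¹ / r) := by
    rw [div_le_iff₀ hr, ← le_div_iff₀ hs]
    ring_nf
  rw [e1, e2] at h
  tauto

lemma latticeCount_swap (hΓ : IsConvexDecreasingCurve f g L M) {r s : ℝ} (hr : 0 < r)
    (hs : 0 < s) : latticeCount f L r s = latticeCount g M r s⁻¹ := by
  have : latticePoints f L r s = Prod.swap ⁻¹' latticePoints g M r s⁻¹ := by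
    ext p
    exact hΓ.mem_latticePoints_iff_swap hr hs p
  rw [latticeCount, latticeCount, this, ← image_swap_eq_preimage_swap,
    ncard_image_of_injective _ Prod.swap_injective]

end IsConvexDecreasingCurve

lemma ncard_setOf_columns (J : Finset ℕ) (φ : ℕ → ℕ) :
    {p : ℕ × ℕ | p.1 ∈ J ∧ 1 ≤ p.2 ∧ p.2 ≤ φ p.1}.ncard = ∑ j ∈ J, φ j := by
  have e : {p : ℕ × ℕ | p.1 ∈ J ∧ 1 ≤ p.2 ∧ p.2 ≤ φ p.1} =
      ((J.sigma fun j => Finset.Icc 1 (φ j)).map (Equiv.sigmaEquivProd ℕ ℕ).toEmbedding :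
        Finset (ℕ × ℕ)) := by
    ext ⟨j, k⟩
    simp [Equiv.sigmaEquivProd]
  rw [e, ncard_coe_finset, Finset.card_map, Finset.card_sigma]
  simp

lemma ncard_setOf_rows (J : Finset ℕ) (φ : ℕ → ℕ) :
    {p : ℕ × ℕ | p.2 ∈ J ∧ 1 ≤ p.1 ∧ p.1 ≤ φ p.2}.ncard = ∑ j ∈ J, φ j := by
  rw [← ncard_setOf_columns, ← ncard_image_of_injective _ Prod.swap_injective,
    image_swap_eq_preimage_swap]
  rfl

lemma mem_latticePoints_iff_floor {f g : ℝ → ℝ} {L M r s : ℝ}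
    (hΓ : IsConvexDecreasingCurve f g L M) (hr : 0 < r) (hs : 0 < s) (p : ℕ × ℕ) :
    p ∈ latticePoints f L r s ↔
      p.1 ∈ Finset.Ioc 0 ⌊r * L / s⌋₊ ∧ 1 ≤ p.2 ∧ p.2 ≤ ⌊r * s * f (p.1 * s / r)⌋₊ := by
  have hL := hΓ.L_pos
  simp only [latticePoints, mem_ofPred_eq, Finset.mem_Ioc]
  have e1 : (p.1 : ℝ) * s / r ≤ L ↔ p.1 ≤ ⌊r * L / s⌋₊ := by
    rw [Nat.le_floor_iff (by positivity), le_div_iff₀ hs, div_le_iff₀ hr, mul_comm L]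
  have e2 : p.2 ≠ 0 → ((p.2 : ℝ) ≤ r * s * f (p.1 * s / r) ↔
      p.2 ≤ ⌊r * s * f (p.1 * s / r)⌋₊) := fun h => (Nat.le_floor_iff' h).symm
  rw [e1]
  constructor
  · rintro ⟨h1, h2, h3, h4⟩
    exact ⟨⟨by omega, h3⟩, h2, (e2 (by omega)).1 h4⟩
  · rintro ⟨⟨h1, h3⟩, h2, h4⟩
    exact ⟨by omega, h2, h3, (e2 (by omega)).2 h4⟩

lemma latticeCount_eq_sum {f g : ℝ → ℝ} {L M r s : ℝ}
    (hΓ : IsConvexDecreasingCurve f g L M) (hr : 0 < r) (hs : 0 < s) :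
    latticeCount f L r s = ∑ j ∈ Finset.Ioc 0 ⌊r * L / s⌋₊, ⌊r * s * f (j * s / r)⌋₊ := by
  rw [latticeCount, ← ncard_setOf_columns]
  congr 1
  ext p
  exact mem_latticePoints_iff_floor hΓ hr hs p

/-- Splitting the lattice points at the point `(α, β)` of the curve. -/
lemma latticeCount_eq_add {f g : ℝ → ℝ} {L M r s α β : ℝ}
    (hΓ : IsConvexDecreasingCurve f g L M) (hr : 0 < r) (hs : 0 < s) (hα : α ∈ Icc 0 L)
    (hβ : f α = β) :
    latticeCount f L r s = ∑ j ∈ Finset.Ioc ⌊r * α / s⌋₊ ⌊r * L / s⌋₊, ⌊r * s * f (j * s / r)⌋₊ +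
      ∑ k ∈ Finset.Ioc ⌊r * β / s⁻¹⌋₊ ⌊r * M / s⁻¹⌋₊, ⌊r * s⁻¹ * g (k * s⁻¹ / r)⌋₊ +
      ⌊r * α / s⌋₊ * ⌊r * β / s⁻¹⌋₊ := by
  have hβm : β ∈ Icc 0 M := hβ ▸ hΓ.mapsTo_f hα
  have hs' : 0 < s⁻¹ := inv_pos.2 hs
  have hα0 := hα.1
  have hβ0 := hβm.1
  set A := ⌊r * α / s⌋₊ with hA
  set B := ⌊r * β / s⁻¹⌋₊ with hB
  -- `P₁` is counted by columns right of α, `P₂` by rows above β, and `P₃` is the full rectangle of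
  -- `A * B` points.
  set P₁ : Set (ℕ × ℕ) := {p | p.1 ∈ Finset.Ioc A ⌊r * L / s⌋₊ ∧ 1 ≤ p.2 ∧
    p.2 ≤ ⌊r * s * f (p.1 * s / r)⌋₊} with hP₁
  set P₂ : Set (ℕ × ℕ) := {p | p.2 ∈ Finset.Ioc B ⌊r * M / s⁻¹⌋₊ ∧ 1 ≤ p.1 ∧
    p.1 ≤ ⌊r * s⁻¹ * g (p.2 * s⁻¹ / r)⌋₊} with hP₂
  set P₃ : Set (ℕ × ℕ) := {p | p.1 ∈ Finset.Ioc 0 A ∧ 1 ≤ p.2 ∧ p.2 ≤ B} with hP₃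
  have m₁ : ∀ p, p ∈ P₁ ↔ p ∈ latticePoints f L r s ∧ A < p.1 := fun p => by
    rw [mem_latticePoints_iff_floor hΓ hr hs, hP₁, mem_ofPred_eq, Finset.mem_Ioc, Finset.mem_Ioc]
    constructor
    · rintro ⟨h1, h2, h3⟩
      exact ⟨⟨⟨by omega, h1.2⟩, h2, h3⟩, h1.1⟩
    · rintro ⟨⟨h1, h2, h3⟩, h4⟩
      exact ⟨⟨h4, h1.2⟩, h2, h3⟩
  have m₂ : ∀ p, p ∈ P₂ ↔ p ∈ latticePoints f L r s ∧ B < p.2 := fun p => by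
    rw [hΓ.mem_latticePoints_iff_swap hr hs, mem_latticePoints_iff_floor hΓ.symm hr hs', hP₂,
      mem_ofPred_eq, Finset.mem_Ioc, Finset.mem_Ioc]
    simp only [Prod.fst_swap, Prod.snd_swap]
    constructor
    · rintro ⟨h1, h2, h3⟩
      exact ⟨⟨⟨by omega, h1.2⟩, h2, h3⟩, h1.1⟩
    · rintro ⟨⟨h1, h2, h3⟩, h4⟩
      exact ⟨⟨h4, h1.2⟩, h2, h3⟩
  have xA : ∀ j : ℕ, j ≤ A ↔ (j : ℝ) * s / r ≤ α := fun j => by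
    rw [hA, Nat.le_floor_iff (by positivity), le_div_iff₀ hs, div_le_iff₀ hr, mul_comm α]
  have yB : ∀ k : ℕ, k ≤ B ↔ (k : ℝ) * s⁻¹ / r ≤ β := fun k => by
    rw [hB, Nat.le_floor_iff (by positivity), le_div_iff₀ hs', div_le_iff₀ hr, mul_comm β]
  have y_le : ∀ j k : ℕ, (k : ℝ) ≤ r * s * f (j * s / r) ↔ (k : ℝ) * s⁻¹ / r ≤ f (j * s / r) :=
    fun j k => by
      rw [← div_eq_mul_inv, div_div, div_le_iff₀ (by positivity)]
      ring_nf
  have m₃ : ∀ p, p ∈ P₃ ↔ p ∈ latticePoints f L r s ∧ p.1 ≤ A ∧ p.2 ≤ B := fun p => by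
    obtain ⟨j, k⟩ := p
    simp only [hP₃, latticePoints, mem_ofPred_eq, Finset.mem_Ioc]
    constructor
    · rintro ⟨⟨h1, h2⟩, h3, h4⟩
      have hj := (xA j).1 h2
      refine ⟨⟨h1, h3, hj.trans hα.2, ?_⟩, h2, h4⟩
      rw [y_le]
      refine ((yB k).1 h4).trans ?_
      rw [← hβ]
      exact hΓ.strictAntiOn.antitoneOn ⟨by positivity, hj.trans hα.2⟩ hα hj
    · rintro ⟨⟨h1, h2, -, -⟩, h3, h4⟩
      exact ⟨⟨h1, h3⟩, h2, h4⟩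
  -- Monotonicity of `f`: beyond α the curve lies at height at most β, so `P₁` and `P₂` are
  -- disjoint.
  have d₁₂ : ∀ p ∈ latticePoints f L r s, A < p.1 → p.2 ≤ B := by
    rintro ⟨j, k⟩ ⟨h1, h2, h3, h4⟩ h5
    rw [yB]
    rw [y_le] at h4
    refine h4.trans ?_
    rw [← hβ]
    have h6 : α ≤ (j : ℝ) * s / r := by
      by_contra! h
      exact absurd ((xA j).2 h.le) (by simpa using h5)
    exact hΓ.strictAntiOn.antitoneOn hα ⟨hα0.trans h6, h3⟩ h6
  have hfin := latticePoints_finite hΓ hr hs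
  have f₁ : P₁.Finite := hfin.subset fun p hp => ((m₁ p).1 hp).1
  have f₂ : P₂.Finite := hfin.subset fun p hp => ((m₂ p).1 hp).1
  have f₃ : P₃.Finite := hfin.subset fun p hp => ((m₃ p).1 hp).1
  have hU : latticePoints f L r s = (P₁ ∪ P₂) ∪ P₃ := by
    ext p
    rw [mem_union, mem_union, m₁, m₂, m₃, ← and_or_left, ← and_or_left]
    refine (and_iff_left ?_).symm
    omega
  have c₁ : P₁.ncard = _ :=
    ncard_setOf_columns (Finset.Ioc A ⌊r * L / s⌋₊) fun j => ⌊r * s * f (j * s / r)⌋₊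
  have c₂ : P₂.ncard = _ :=
    ncard_setOf_rows (Finset.Ioc B ⌊r * M / s⁻¹⌋₊) fun k => ⌊r * s⁻¹ * g (k * s⁻¹ / r)⌋₊
  have c₃ : P₃.ncard = _ := ncard_setOf_columns (Finset.Ioc 0 A) fun _ => B
  rw [latticeCount, hU, ncard_union_eq _ (f₁.union f₂) f₃, ncard_union_eq _ f₁ f₂, c₁, c₂, c₃]
  · simp
  · rw [disjoint_left]
    intro p h1 h2
    have h1 := (m₁ p).1 h1
    have h2 := (m₂ p).1 h2
    have := d₁₂ p h1.1 h1.2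
    omega
  · rw [disjoint_left]
    rintro p (h1 | h1) h2
    · have h1 := (m₁ p).1 h1
      have h2 := (m₃ p).1 h2
      omega
    · have h1 := (m₂ p).1 h1
      have h2 := (m₃ p).1 h2
      omega

lemma volume_real_regionBetween_const {φ : ℝ → ℝ} {a b c : ℝ} (hab : a ≤ b)
    (hφ : ContinuousOn φ (Icc a b)) (h : ∀ x ∈ Icc a b, c ≤ φ x) :
    volume.real (regionBetween (fun _ => c) φ (Ioo a b)) = ∫ x in a..b, (φ x - c) := by
  rw [measureReal_def, Measure.volume_eq_prod, volume_regionBetween_eq_integral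
    (integrableOn_const (by simp)) (hφ.integrableOn_Icc.mono_set Ioo_subset_Icc_self)
    measurableSet_Ioo fun x hx => h x (Ioo_subset_Icc_self hx), ENNReal.toReal_ofReal,
    intervalIntegral.integral_of_le hab, integral_Ioc_eq_integral_Ioo]
  · rfl
  · refine setIntegral_nonneg measurableSet_Ioo fun x hx => ?_
    exact sub_nonneg.2 (h x (Ioo_subset_Icc_self hx))

namespace IsConvexDecreasingCurve

variable {f g : ℝ → ℝ} {L M : ℝ}

lemma enclosedArea_eq (hΓ : IsConvexDecreasingCurve f g L M) :
    enclosedArea f L = ∫ x in (0 : ℝ)..L, f x := by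
  have := volume_real_regionBetween_const hΓ.L_pos.le hΓ.continuousOn
    fun x hx => (hΓ.mapsTo_f hx).1
  simp only [sub_zero] at this
  rw [← this, enclosedArea]
  congr 1
  ext p
  simp only [regionBetween, mem_ofPred_eq, mem_Ioo]
  tauto

/-- Both integrals are areas of regions that are mirror images in the diagonal, and swapping
coordinates preserves the product measure. -/
lemma integral_sub_eq_integral (hΓ : IsConvexDecreasingCurve f g L M) {α β : ℝ}
    (hα : α ∈ Icc 0 L) (hβ : f α = β) :
    ∫ x in (0 : ℝ)..α, (f x - β) = ∫ y in β..M, g y := by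
  have hβm : β ∈ Icc 0 M := hβ ▸ hΓ.mapsTo_f hα
  have hgβ : g β = α := hβ ▸ hΓ.g_f hα
  have h1 := volume_real_regionBetween_const hα.1 (c := β)
    (hΓ.continuousOn.mono (Icc_subset_Icc_right hα.2)) fun x hx => by
      rw [← hβ]
      exact hΓ.strictAntiOn.antitoneOn ⟨hx.1, hx.2.trans hα.2⟩ hα hx.2
  have h2 := volume_real_regionBetween_const hβm.2 (c := 0)
    (hΓ.symm.continuousOn.mono (Icc_subset_Icc_left hβm.1)) fun y hy =>
      (hΓ.mapsTo_g ⟨hβm.1.trans hy.1, hy.2⟩).1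
  simp only [sub_zero] at h2
  rw [← h1, ← h2]
  have e : regionBetween (fun _ => β) f (Ioo 0 α) =
      Prod.swap ⁻¹' regionBetween (fun _ => 0) g (Ioo β M) := by
    ext ⟨x, y⟩
    simp only [regionBetween, mem_ofPred_eq, mem_Ioo, mem_preimage, Prod.swap]
    constructor
    · rintro ⟨⟨h1, h2⟩, h3, h4⟩
      have hx : x ∈ Icc 0 L := ⟨h1.le, h2.le.trans hα.2⟩
      have hy : y < M := by
        rw [← hΓ.f_zero]
        exact h4.trans (hΓ.strictAntiOn ⟨le_rfl, hΓ.L_pos.le⟩ hx h1)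
      refine ⟨⟨h3, hy⟩, h1, ?_⟩
      have := hΓ.strictAntiOn_g ⟨hβm.1.trans h3.le, hy.le⟩ (hΓ.mapsTo_f hx) h4
      rwa [hΓ.g_f hx] at this
    · rintro ⟨⟨h1, h2⟩, h3, h4⟩
      have hy : y ∈ Icc 0 M := ⟨hβm.1.trans h1.le, h2.le⟩
      have hg := hΓ.strictAntiOn_g hβm hy h1
      rw [hgβ] at hg
      refine ⟨⟨h3, h4.trans hg⟩, h1, ?_⟩
      have := hΓ.strictAntiOn ⟨h3.le, (h4.trans hg).le.trans hα.2⟩ (hΓ.mapsTo_g hy) h4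
      rwa [hΓ.f_g y hy] at this
  rw [e, measureReal_def, measureReal_def, Measure.volume_eq_prod]
  congr 1
  exact Measure.measurePreserving_swap.measure_preimage_emb
    (MeasurableEquiv.prodComm (α := ℝ) (β := ℝ)).measurableEmbedding _

lemma enclosedArea_eq_add (hΓ : IsConvexDecreasingCurve f g L M) {α β : ℝ}
    (hα : α ∈ Icc 0 L) (hβ : f α = β) :
    enclosedArea f L = (∫ x in α..L, f x) + (∫ y in β..M, g y) + α * β := by
  have i1 : IntervalIntegrable f volume 0 α :=
    (hΓ.continuousOn.mono (by rw [uIcc_of_le hα.1]; exact Icc_subset_Icc_right hα.2)).intervalIntegrable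
  have i2 : IntervalIntegrable f volume α L :=
    (hΓ.continuousOn.mono (by rw [uIcc_of_le hα.2]; exact Icc_subset_Icc_left hα.1)).intervalIntegrable
  rw [hΓ.enclosedArea_eq, ← intervalIntegral.integral_add_adjacent_intervals i1 i2,
    ← hΓ.integral_sub_eq_integral hα hβ, intervalIntegral.integral_sub i1 (by simp),
    intervalIntegral.integral_const, smul_eq_mul]
  ring

lemma enclosedArea_symm (hΓ : IsConvexDecreasingCurve f g L M) :
    enclosedArea f L = enclosedArea g M := by
  have := hΓ.integral_sub_eq_integral ⟨hΓ.L_pos.le, le_rfl⟩ hΓ.f_L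
  simp only [sub_zero] at this
  rw [hΓ.enclosedArea_eq, hΓ.symm.enclosedArea_eq, this]

end IsConvexDecreasingCurve

/-! ### Uniform asymptotics for bounded stretch factors. -/

/-- The two-term asymptotics of the counting function, uniformly for bounded stretch factors. -/
theorem exists_abs_latticeCount_sub_le {f g : ℝ → ℝ} {L M α β : ℝ}
    (hΓ : IsConvexDecreasingCurve f g L M) (hα : 0 < α) (hαL : α < L) (hαβ : f α = β)
    (hf : ContDiffOn ℝ 2 f (Icc α L))
    (hf2 : ∀ x ∈ Icc α L, 0 < iteratedDerivWithin 2 f (Icc α L) x)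
    (hg : ContDiffOn ℝ 2 g (Icc β M))
    (hg2 : ∀ y ∈ Icc β M, 0 < iteratedDerivWithin 2 g (Icc β M) y) {T : ℝ} (hT : 1 ≤ T) :
    ∃ C : ℝ, ∀ r s : ℝ, 1 ≤ r → 1 / T ≤ s → s ≤ T →
      |(latticeCount f L r s : ℝ) - (r ^ 2 * enclosedArea f L - r * (L / s + s * M) / 2)| ≤
        C * r ^ (2 / 3 : ℝ) := by
  have hαm : α ∈ Icc 0 L := ⟨hα.le, hαL.le⟩
  have hβ : 0 < β := by
    rw [← hαβ, ← hΓ.f_L]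
    exact hΓ.strictAntiOn hαm ⟨hΓ.L_pos.le, le_rfl⟩ hαL
  have hβM : β < M := by
    rw [← hαβ, ← hΓ.f_zero]
    exact hΓ.strictAntiOn ⟨le_rfl, hΓ.L_pos.le⟩ hαm hα
  have hgβ : g β = α := hαβ ▸ hΓ.g_f hαm
  have lip : ∀ {φ : ℝ → ℝ} {a b : ℝ}, ContDiffOn ℝ 2 φ (Icc a b) →
      ∃ Λ : ℝ, ∀ x ∈ Icc a b, ∀ y ∈ Icc a b, |φ x - φ y| ≤ Λ * |x - y| := by
    intro φ a b h
    obtain ⟨K, hK⟩ := h.exists_lipschitzOnWith (by norm_num) (convex_Icc a b) isCompact_Icc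
    refine ⟨K, fun x hx y hy => ?_⟩
    simpa [Real.dist_eq] using hK.dist_le_mul x hx y hy
  have arc : ∀ {φ γ : ℝ → ℝ} {A B a : ℝ}, IsConvexDecreasingCurve φ γ A B → 0 < a → a < A →
      ContDiffOn ℝ 2 φ (Icc a A) → (∀ x ∈ Icc a A, 0 < iteratedDerivWithin 2 φ (Icc a A) x) →
      ∃ C : ℝ, ∀ r s : ℝ, 1 ≤ r → 1 / T ≤ s → s ≤ T →
      |∑ j ∈ Finset.Ioc ⌊r * a / s⌋₊ ⌊r * A / s⌋₊, (⌊r * s * φ (j * s / r)⌋₊ : ℝ) -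
        (r ^ 2 * (∫ x in a..A, φ x) + r * s * φ a * sawtooth (r * a / s) -
          r * (A - a) / s / 2)| ≤ C * r ^ (2 / 3 : ℝ) := by
    intro φ γ A B a h ha haA hφ hφ2
    obtain ⟨m, K, hm, hK, hc⟩ := exists_hasCurvatureBounds haA hφ hφ2
    obtain ⟨Λ, hΛ⟩ := lip hφ
    exact exists_abs_arc_count_sub_le ha haA hm hK hφ.continuousOn h.f_L
      (fun x hx => (h.mapsTo_f ⟨ha.le.trans hx.1, hx.2⟩).1) hc hΛ hT
  obtain ⟨C₁, h₁⟩ := arc hΓ hα hαL hf hf2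
  obtain ⟨C₂, h₂⟩ := arc hΓ.symm hβ hβM hg hg2
  refine ⟨C₁ + C₂ + 1, fun r s hr hs1 hs2 => ?_⟩
  have hT0 : 0 < T := by linarith
  have hr0 : 0 < r := by linarith
  have hs0 : 0 < s := (by positivity : 0 < 1 / T).trans_le hs1
  have b₁ := h₁ r s hr hs1 hs2
  have b₂ := h₂ r s⁻¹ hr (by rw [one_div]; exact inv_anti₀ hs0 hs2)
    (by rw [one_div] at hs1; exact inv_le_of_inv_le₀ hT0 hs1)
  have hρ : 1 ≤ r ^ (2 / 3 : ℝ) := Real.one_le_rpow hr (by norm_num)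
  rw [latticeCount_eq_add hΓ hr0 hs0 hαm hαβ, hΓ.enclosedArea_eq_add hαm hαβ]
  push_cast
  set a := r * α / s with ha
  set b := r * β / s⁻¹ with hb
  have fl : ∀ x : ℝ, 0 ≤ x → (⌊x⌋₊ : ℝ) = x - 1 / 2 - sawtooth x := fun x hx => by
    rw [natCast_floor_eq_intCast_floor hx, sawtooth, Int.fract]; ring
  rw [fl a (by positivity), fl b (by positivity)]
  have s₁ := abs_le.1 (abs_sawtooth_le a)
  have s₂ := abs_le.1 (abs_sawtooth_le b)
  -- With ⌊a⌋ = a − (1/2 + ψ(a)) and likewise for `b`, the cross terms of ⌊a⌋⌊b⌋ cancel the terms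
  -- bψ(a) + a/2 and aψ(b) + b/2 coming from the two arcs. Besides ab = r²αβ, only this product in
  -- [0, 1] survives.
  have p1 : 0 ≤ (1 / 2 + sawtooth a) * (1 / 2 + sawtooth b) :=
    mul_nonneg (by linarith [s₁.1]) (by linarith [s₂.1])
  have p2 : (1 / 2 + sawtooth a) * (1 / 2 + sawtooth b) ≤ 1 * 1 :=
    mul_le_mul (by linarith [s₁.2]) (by linarith [s₂.2]) (by linarith [s₂.1]) zero_le_one
  have e1 : r * s * f α = b := by rw [hαβ, hb]; field_simp
  have e2 : r * s⁻¹ * g β = a := by rw [hgβ, ha]; field_simp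
  have e3 : r * (L - α) / s / 2 = r * (L / s) / 2 - a / 2 := by rw [ha]; ring
  have e4 : r * (M - β) / s⁻¹ / 2 = r * (s * M) / 2 - b / 2 := by rw [hb]; field_simp
  have e5 : a * b = r ^ 2 * (α * β) := by rw [ha, hb]; field_simp
  rw [e1, e3] at b₁
  rw [e2, e4] at b₂
  rw [abs_le] at *
  constructor <;> nlinarith [b₁.1, b₁.2, b₂.1, b₂.2]

/-! ### An upper bound for all stretch factors, and existence of the maximum. -/

/-- On [x, x + 1] a convex function lies above the extension of its chord over [x + 1, x + 2]; the
left side is the integral of that line. -/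
lemma le_integral_of_convexOn {F : ℝ → ℝ} {b x : ℝ} (hF : ContinuousOn F (Icc 0 b))
    (hconv : ConvexOn ℝ (Icc 0 b) F) (hx : 0 ≤ x) (hxb : x + 2 ≤ b) :
    F (x + 1) + (F (x + 1) - F (x + 2)) / 2 ≤ ∫ y in x..x + 1, F y := by
  have e : F (x + 1) + (F (x + 1) - F (x + 2)) / 2 =
      ∫ y in x..x + 1, (F (x + 1) + (x + 1 - y) * (F (x + 1) - F (x + 2))) := by
    rw [intervalIntegral.integral_add (by simp) (by
      apply Continuous.intervalIntegrable; fun_prop), intervalIntegral.integral_mul_const,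
      intervalIntegral.integral_sub (by simp) (by simp)]
    simp
    ring
  rw [e]
  refine intervalIntegral.integral_mono_on (by linarith)
    (by apply Continuous.intervalIntegrable; fun_prop)
    (hF.mono (by
      rw [uIcc_of_le (by linarith)]
      exact Icc_subset_Icc hx (by linarith))).intervalIntegrable fun y hy => ?_
  have hd : 0 < x + 2 - y := by linarith [hy.2]
  have my : y ∈ Icc 0 b := ⟨hx.trans hy.1, by linarith [hy.2]⟩
  have mx : x + 2 ∈ Icc 0 b := ⟨by linarith, hxb⟩
  have w1 : 0 ≤ 1 / (x + 2 - y) := by positivity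
  have w2 : 0 ≤ (x + 1 - y) / (x + 2 - y) := div_nonneg (by linarith [hy.2]) hd.le
  have h := hconv.2 my mx w1 w2 (by field_simp; ring)
  simp only [smul_eq_mul] at h
  rw [show 1 / (x + 2 - y) * y + (x + 1 - y) / (x + 2 - y) * (x + 2) = x + 1 by
    field_simp; ring] at h
  have h2 := mul_le_mul_of_nonneg_right h hd.le
  have e2 : (1 / (x + 2 - y) * F y + (x + 1 - y) / (x + 2 - y) * F (x + 2)) * (x + 2 - y) =
      F y + (x + 1 - y) * F (x + 2) := by field_simp
  rw [e2] at h2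
  linarith

/-- The lower Riemann sum of a convex decreasing function falls short of the integral by at least
half of the total decrease. -/
lemma sum_add_le_integral_of_convexOn {F : ℝ → ℝ} {b : ℝ} (hF : ContinuousOn F (Icc 0 b))
    (hconv : ConvexOn ℝ (Icc 0 b) F) (m : ℕ) (hm : (m : ℝ) + 1 ≤ b) :
    ∑ i ∈ Finset.range m, F (i + 1) + (F 1 - F (m + 1)) / 2 ≤ ∫ x in (0 : ℝ)..m, F x := by
  induction m with
  | zero => simp
  | succ m ih =>
    push_cast at hm ⊢
    have hm0 : (0 : ℝ) ≤ m := m.cast_nonneg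
    have ih := ih (by linarith)
    have h := le_integral_of_convexOn hF hconv hm0 (by linarith)
    have hi : ∀ x y : ℝ, 0 ≤ x → x ≤ y → y ≤ b → IntervalIntegrable F volume x y :=
      fun x y h1 h2 h3 =>
        (hF.mono (by rw [uIcc_of_le h2]; exact Icc_subset_Icc h1 h3)).intervalIntegrable
    rw [Finset.sum_range_succ, ← intervalIntegral.integral_add_adjacent_intervals
      (hi 0 m le_rfl hm0 (by linarith)) (hi m (m + 1) hm0 (by linarith) (by linarith)),
      show (m : ℝ) + 1 + 1 = m + 2 by ring]
    linarith

lemma mul_le_integral_of_antitoneOn {F : ℝ → ℝ} {a b x y : ℝ} (hF : ContinuousOn F (Icc a b))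
    (hanti : AntitoneOn F (Icc a b)) (hx : a ≤ x) (hxy : x ≤ y) (hy : y ≤ b) :
    (y - x) * F y ≤ ∫ t in x..y, F t := by
  have e : (y - x) * F y = ∫ _ in x..y, F y := by simp
  rw [e]
  refine intervalIntegral.integral_mono_on hxy (by simp)
    (hF.mono (by rw [uIcc_of_le hxy]; exact Icc_subset_Icc hx hy)).intervalIntegrable
    fun t ht => hanti ⟨hx.trans ht.1, ht.2.trans hy⟩ ⟨hx.trans hxy, hy⟩ ht.2

namespace IsConvexDecreasingCurve

variable {f g : ℝ → ℝ} {L M : ℝ}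

lemma intervalIntegrable (hΓ : IsConvexDecreasingCurve f g L M) {x y : ℝ} (hx : 0 ≤ x)
    (hxy : x ≤ y) (hy : y ≤ L) : IntervalIntegrable f volume x y :=
  (hΓ.continuousOn.mono (by rw [uIcc_of_le hxy]; exact Icc_subset_Icc hx hy)).intervalIntegrable

/-- A rectangle inscribed in the curve with a corner on its right half misses a fixed area. -/
lemma mul_add_le_enclosedArea (hΓ : IsConvexDecreasingCurve f g L M) {u : ℝ} (h1 : L / 2 ≤ u)
    (h2 : u ≤ L) : u * f u + L / 4 * (f (L / 4) - f (L / 2)) ≤ enclosedArea f L := by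
  have hL := hΓ.L_pos
  have hanti := hΓ.strictAntiOn.antitoneOn
  -- Over [0, L/4] the curve stays above f(L/4), hence exceeds the rectangle's height f(u) ≤ f(L/2)
  -- by a fixed amount.
  have a1 := mul_le_integral_of_antitoneOn hΓ.continuousOn hanti le_rfl
    (show 0 ≤ L / 4 by linarith) (by linarith)
  have a2 := mul_le_integral_of_antitoneOn hΓ.continuousOn hanti
    (show 0 ≤ L / 4 by linarith) (show L / 4 ≤ u by linarith) h2
  have a3 := mul_le_integral_of_antitoneOn hΓ.continuousOn hanti (show 0 ≤ u by linarith) h2 le_rfl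
  rw [hΓ.f_L, mul_zero] at a3
  have a4 : f u ≤ f (L / 2) := hanti ⟨by linarith, by linarith⟩ ⟨by linarith, h2⟩ h1
  rw [hΓ.enclosedArea_eq, ← intervalIntegral.integral_add_adjacent_intervals
    (hΓ.intervalIntegrable le_rfl (show 0 ≤ u by linarith) h2)
    (hΓ.intervalIntegrable (show 0 ≤ u by linarith) h2 le_rfl),
    ← intervalIntegral.integral_add_adjacent_intervals
    (hΓ.intervalIntegrable le_rfl (show 0 ≤ L / 4 by linarith) (by linarith))
    (hΓ.intervalIntegrable (show 0 ≤ L / 4 by linarith) (show L / 4 ≤ u by linarith) h2)]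
  nlinarith

/-- Here at least two columns meet the region. The count is at most a lower Riemann sum of a convex
function, and the saving is half the drop between the first and the last column. That drop has order
`r * s`, because the first column lies left of L/2 and the last right of 2L/3. -/
lemma latticeCount_le_of_two_mul_le (hΓ : IsConvexDecreasingCurve f g L M) {r s : ℝ} (hr : 0 < r)
    (hs : 0 < s) (h : 2 * s ≤ r * L) :
    (latticeCount f L r s : ℝ) ≤
      r ^ 2 * enclosedArea f L - (f (L / 2) - f (2 * L / 3)) / 2 * r * s := by
  have hL := hΓ.L_pos
  have hrs : 0 < r * s := mul_pos hr hs
  set b := r * L / s with hb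
  have hb2 : 2 ≤ b := by rwa [hb, le_div_iff₀ hs]
  have hb0 : 0 ≤ b := by linarith
  set F : ℝ → ℝ := fun x => r * s * f (x * s / r) with hFd
  have eb : b * s / r = L := by rw [hb]; field_simp
  have hmem : ∀ x ∈ Icc 0 b, x * s / r ∈ Icc 0 L := fun x hx => by
    have h2 := hx.2
    have h1 := hx.1
    rw [hb, le_div_iff₀ hs] at h2
    exact ⟨by positivity, by rw [div_le_iff₀ hr]; linarith⟩
  have hF : ContinuousOn F (Icc 0 b) :=
    continuousOn_const.mul (hΓ.continuousOn.comp (by fun_prop) hmem)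
  have hanti : AntitoneOn F (Icc 0 b) := fun x hx y hy hxy => by
    simp only [hFd]
    exact mul_le_mul_of_nonneg_left
      (hΓ.strictAntiOn.antitoneOn (hmem x hx) (hmem y hy) (by gcongr)) hrs.le
  have hconv : ConvexOn ℝ (Icc 0 b) F := by
    refine ⟨convex_Icc 0 b, fun x hx y hy p q hp hq hpq => ?_⟩
    have := hΓ.convexOn.2 (hmem x hx) (hmem y hy) hp hq hpq
    simp only [smul_eq_mul, hFd] at this ⊢
    rw [show (p * x + q * y) * s / r = p * (x * s / r) + q * (y * s / r) by ring]
    nlinarith [mul_le_mul_of_nonneg_left this hrs.le]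
  have hint : (∫ x in (0 : ℝ)..b, F x) = r ^ 2 * enclosedArea f L := by
    simp only [hFd]
    rw [hΓ.enclosedArea_eq, intervalIntegral.integral_const_mul]
    have := intervalIntegral.integral_comp_mul_right (a := 0) (b := b) f (div_pos hs hr).ne'
    simp only [← mul_div_assoc, zero_mul] at this
    rw [this, eb, smul_eq_mul, zero_div]
    field_simp
  have hq2 : 2 ≤ ⌊b⌋₊ := Nat.le_floor (by exact_mod_cast hb2)
  obtain ⟨m, hm⟩ := Nat.exists_eq_add_of_le' (show 1 ≤ ⌊b⌋₊ by omega)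
  have fb1 := Nat.floor_le hb0
  have fb2 := Nat.lt_floor_add_one b
  rw [hm] at fb1 fb2
  have hm1 : (1 : ℝ) ≤ m := by
    have : 1 ≤ m := by omega
    exact_mod_cast this
  push_cast at fb1 fb2
  have hcount : (latticeCount f L r s : ℝ) ≤ ∑ i ∈ Finset.range (m + 1), F (i + 1) := by
    have e : Finset.Ioc 0 ⌊b⌋₊ = Finset.Ico 1 (⌊b⌋₊ + 1) := by
      ext; simp; omega
    rw [latticeCount_eq_sum hΓ hr hs, e, Finset.sum_Ico_eq_sum_range, hm, Nat.add_sub_cancel]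
    push_cast
    refine Finset.sum_le_sum fun i hi => ?_
    have hi : (i : ℝ) ≤ m := by
      have := Finset.mem_range.1 hi
      exact_mod_cast (show i ≤ m by omega)
    simp only [hFd]
    rw [add_comm (1 : ℝ)]
    exact Nat.floor_le (mul_nonneg hrs.le
      (hΓ.mapsTo_f (hmem (i + 1) ⟨by positivity, by linarith⟩)).1)
  -- The convexity saving uses the next node to the right, so it is applied to all columns but the
  -- last; the last one is bounded by monotonicity, and the leftover piece up to `b` is nonnegative.
  have c1 := sum_add_le_integral_of_convexOn hF hconv m fb1
  have c2 := mul_le_integral_of_antitoneOn hF hanti (x := m) (y := m + 1) m.cast_nonneg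
    (by linarith) fb1
  have c3 := mul_le_integral_of_antitoneOn hF hanti (x := m + 1) (y := b) (by positivity) fb1 le_rfl
  have hFb : F b = 0 := by simp only [hFd]; rw [eb, hΓ.f_L, mul_zero]
  rw [hFb, mul_zero] at c3
  have hi : ∀ x y : ℝ, 0 ≤ x → x ≤ y → y ≤ b → IntervalIntegrable F volume x y :=
    fun x y h1 h2 h3 =>
      (hF.mono (by rw [uIcc_of_le h2]; exact Icc_subset_Icc h1 h3)).intervalIntegrable
  rw [← intervalIntegral.integral_add_adjacent_intervals
    (hi 0 (m + 1) le_rfl (by positivity) fb1) (hi (m + 1) b (by positivity) fb1 le_rfl),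
    ← intervalIntegral.integral_add_adjacent_intervals
    (hi 0 m le_rfl m.cast_nonneg (by linarith)) (hi m (m + 1) m.cast_nonneg (by linarith) fb1)]
    at hint
  have d1 : r * s * f (L / 2) ≤ F 1 := by
    simp only [hFd]
    gcongr
    refine hΓ.strictAntiOn.antitoneOn (hmem 1 ⟨zero_le_one, by linarith⟩)
      ⟨by linarith, by linarith⟩ ?_
    rw [div_le_iff₀ hr]
    linarith
  have d2 : F (m + 1) ≤ r * s * f (2 * L / 3) := by
    simp only [hFd]
    gcongr
    refine hΓ.strictAntiOn.antitoneOn ⟨by linarith, by linarith⟩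
      (hmem (m + 1) ⟨by positivity, fb1⟩) ?_
    -- From b < q + 1 with q = m + 1 ≥ 2 it follows that q/b > q/(q + 1) ≥ 2/3.
    have : 2 / 3 * b ≤ (m : ℝ) + 1 := by linarith
    calc 2 * L / 3 = 2 / 3 * b * s / r := by rw [← eb]; ring
      _ ≤ _ := by gcongr
  rw [Finset.sum_range_succ] at hcount
  linarith

/-- At most one column meets the region. Its count is bounded by r² times the area of an inscribed
rectangle with corner in the right half, which misses a fixed part of the area. -/
lemma latticeCount_le_of_lt_two_mul (hΓ : IsConvexDecreasingCurve f g L M) {r s : ℝ} (hr : 0 < r)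
    (hs : 0 < s) (h : r * L < 2 * s) :
    (latticeCount f L r s : ℝ) ≤
      r ^ 2 * enclosedArea f L - L / 4 * (f (L / 4) - f (L / 2)) * r ^ 2 := by
  have hL := hΓ.L_pos
  have hr2 : 0 ≤ r ^ 2 := by positivity
  have hb2 : ⌊r * L / s⌋₊ < 2 := by
    rw [Nat.floor_lt (by positivity), div_lt_iff₀ hs]
    exact_mod_cast h
  rw [latticeCount_eq_sum hΓ hr hs]
  rcases Nat.eq_zero_or_pos ⌊r * L / s⌋₊ with h0 | h0
  · have := mul_le_mul_of_nonneg_left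
      (hΓ.mul_add_le_enclosedArea (u := L) (by linarith) le_rfl) hr2
    rw [hΓ.f_L, mul_zero, zero_add] at this
    rw [h0]
    simp
    linarith
  · have h1 : ⌊r * L / s⌋₊ = 1 := by omega
    have hsr : s / r ≤ L := by
      have := (Nat.le_floor_iff (by positivity)).1 h0
      rw [Nat.succ_eq_add_one, zero_add, Nat.cast_one, le_div_iff₀ hs] at this
      rw [div_le_iff₀ hr]
      linarith
    have hsr2 : L / 2 ≤ s / r := by
      rw [le_div_iff₀ hr]
      linarith
    have := mul_le_mul_of_nonneg_left (hΓ.mul_add_le_enclosedArea hsr2 hsr) hr2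
    have hf0 := (hΓ.mapsTo_f (x := s / r) ⟨by positivity, hsr⟩).1
    have e : r ^ 2 * (s / r * f (s / r)) = r * s * f (s / r) := by field_simp
    have hle : (⌊r * s * f (s / r)⌋₊ : ℝ) ≤ r * s * f (s / r) := Nat.floor_le (by positivity)
    rw [h1]
    simp
    linarith

/-- A two-term upper bound for the counting function, for all stretch factors. -/
lemma exists_latticeCount_le (hΓ : IsConvexDecreasingCurve f g L M) :
    ∃ c : ℝ, 0 < c ∧ ∀ r s : ℝ, 0 < r → 0 < s →
      (latticeCount f L r s : ℝ) ≤ r ^ 2 * enclosedArea f L - c * r * min s r := by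
  have hL := hΓ.L_pos
  have c1 : 0 < (f (L / 2) - f (2 * L / 3)) / 2 := by
    have := hΓ.strictAntiOn (a := L / 2) (b := 2 * L / 3) ⟨by linarith, by linarith⟩
      ⟨by linarith, by linarith⟩ (by linarith)
    linarith
  have c2 : 0 < L / 4 * (f (L / 4) - f (L / 2)) := by
    have := hΓ.strictAntiOn (a := L / 4) (b := L / 2) ⟨by linarith, by linarith⟩
      ⟨by linarith, by linarith⟩ (by linarith)
    exact mul_pos (by linarith) (by linarith)
  refine ⟨_, lt_min c1 c2, fun r s hr hs => ?_⟩
  rcases le_or_gt (2 * s) (r * L) with h | h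
  · refine (hΓ.latticeCount_le_of_two_mul_le hr hs h).trans ?_
    gcongr
    · exact min_le_left _ _
    · exact min_le_left _ _
  · refine (hΓ.latticeCount_le_of_lt_two_mul hr hs h).trans ?_
    rw [sq r, ← mul_assoc]
    gcongr
    · exact min_le_right _ _
    · exact min_le_right _ _

/-- The counts are natural numbers bounded by r² Area uniformly in `s`, so their supremum is
attained. -/
lemma exists_isGreatest_latticeCount (hΓ : IsConvexDecreasingCurve f g L M) {r : ℝ} (hr : 0 < r) :
    IsGreatest (latticeCount f L r '' Ioi 0) (sSup (latticeCount f L r '' Ioi 0)) := by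
  obtain ⟨c, hc, h⟩ := hΓ.exists_latticeCount_le
  have hb : BddAbove (latticeCount f L r '' Ioi 0) := by
    refine ⟨⌊r ^ 2 * enclosedArea f L⌋₊, ?_⟩
    rintro _ ⟨s, hs, rfl⟩
    refine Nat.le_floor ((h r s hr hs).trans (sub_le_self _ ?_))
    have : 0 < min s r := lt_min hs hr
    positivity
  exact ⟨Nat.sSup_mem ⟨_, mem_image_of_mem _ (mem_Ioi.2 one_pos)⟩ hb, fun _ hx => le_csSup hb hx⟩

end IsConvexDecreasingCurve

/-! ### Localization of the maximizers and the value of the maximum. -/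

/-- The function s + 1/s − 2 = (s − 1)²/s vanishes quadratically at 1; this is where the exponent
1/3 is halved to 1/6. -/
lemma abs_sub_one_le_of_add_inv_le {s T D : ℝ} (hs : 0 < s) (hsT : s ≤ T) (hD : 0 ≤ D)
    (h : s + 1 / s - 2 ≤ D) : |s - 1| ≤ √(T * D) := by
  refine Real.abs_le_sqrt ?_
  have e : (s - 1) ^ 2 = s * (s + 1 / s - 2) := by field_simp; ring
  rw [e]
  calc s * (s + 1 / s - 2) ≤ s * D := by gcongr
    _ ≤ T * D := by gcongr

theorem mainTheorem5 (f g : ℝ → ℝ) (L M α β : ℝ)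
    (hΓ : IsConvexDecreasingCurve f g L M)
    (hα : 0 < α) (hβ : 0 < β) (hαβ : f α = β) (hαL : α < L / 2) (hβM : β < M / 2)
    (hf : ContDiffOn ℝ 2 f (Icc α L))
    (hf' : ∀ x ∈ Ico α L, derivWithin f (Icc α L) x < 0)
    (hf'' : ∀ x ∈ Icc α L, 0 < iteratedDerivWithin 2 f (Icc α L) x)
    (hfmono : MonotoneOn (iteratedDerivWithin 2 f (Icc α L)) (Icc α L) ∨
      AntitoneOn (iteratedDerivWithin 2 f (Icc α L)) (Icc α L))
    (hg : ContDiffOn ℝ 2 g (Icc β M))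
    (hg' : ∀ y ∈ Ico β M, derivWithin g (Icc β M) y < 0)
    (hg'' : ∀ y ∈ Icc β M, 0 < iteratedDerivWithin 2 g (Icc β M) y)
    (hgmono : MonotoneOn (iteratedDerivWithin 2 g (Icc β M)) (Icc β M) ∨
      AntitoneOn (iteratedDerivWithin 2 g (Icc β M)) (Icc β M))
    (hLM : L = M) :
    (∃ C : ℝ, ∀ᶠ r : ℝ in atTop,
      optimalStretch f L r ⊆
        Icc (1 - C * r ^ (-(1 / 6) : ℝ)) (1 + C * r ^ (-(1 / 6) : ℝ))) ∧
    ∃ maxN : ℝ → ℕ,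
      (∀ r : ℝ, 0 < r → IsGreatest (latticeCount f L r '' Ioi 0) (maxN r)) ∧
      (fun r : ℝ => (maxN r : ℝ) - (r ^ 2 * enclosedArea f L - r * L))
        =O[atTop] fun r : ℝ => r ^ (2 / 3 : ℝ) := by
  have hL := hΓ.L_pos
  have asymp := fun {T : ℝ} (hT : 1 ≤ T) => exists_abs_latticeCount_sub_le hΓ hα
    (by linarith) hαβ hf hf'' hg hg'' hT
  rw [← hLM] at asymp
  obtain ⟨C₁, hC₁⟩ := asymp le_rfl
  obtain ⟨c, hc, hub⟩ := hΓ.exists_latticeCount_le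
  obtain ⟨c', hc', hub'⟩ := hΓ.symm.exists_latticeCount_le
  rw [← hΓ.enclosedArea_symm] at hub'
  have low : ∀ r : ℝ, 1 ≤ r →
      r ^ 2 * enclosedArea f L - r * L - |C₁| * r ^ (2 / 3 : ℝ) ≤ latticeCount f L r 1 := by
    intro r hr
    have h := (abs_le.1 (hC₁ r 1 hr (by norm_num) le_rfl)).1
    have h2 := mul_le_mul_of_nonneg_right (le_abs_self C₁)
      (Real.rpow_nonneg (zero_le_one.trans hr) (2 / 3 : ℝ))
    rw [div_one, one_mul] at h
    linarith
  set D : ℝ := L + |C₁| with hD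
  have hD0 : 0 < D := by positivity
  have low' : ∀ r : ℝ, 1 ≤ r → r ^ 2 * enclosedArea f L - D * r ≤ latticeCount f L r 1 := by
    intro r hr
    have h := low r hr
    have h2 : r ^ (2 / 3 : ℝ) ≤ r := by
      simpa using Real.rpow_le_rpow_of_exponent_le hr (show (2 / 3 : ℝ) ≤ 1 by norm_num)
    have h3 := mul_le_mul_of_nonneg_left h2 (abs_nonneg C₁)
    rw [hD]
    linarith
  -- The inequality bounds min(t, r) by D/k, and for r > D/k the minimum can only be `t`.
  have bound : ∀ k r t : ℝ, 0 < k → 1 ≤ r → D / k < r → k * r * min t r ≤ D * r → t ≤ D / k := by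
    intro k r t hk hr hkr h
    have h1 : min t r ≤ D / k := by
      rw [le_div_iff₀ hk]
      refine le_of_mul_le_mul_right ?_ (show 0 < r by linarith)
      linarith
    rcases min_le_iff.1 h1 with h2 | h2
    · exact h2
    · linarith
  -- `T` bounds both `s` and `1/s` for every maximizer once r > T, through the upper bounds for the
  -- curve and for its reflection.
  set T : ℝ := max 1 (max (D / c) (D / c')) with hT
  have hT1 : 1 ≤ T := le_max_left _ _
  have hT0 : 0 < T := by linarith
  have hTc : D / c ≤ T := (le_max_left _ _).trans (le_max_right _ _)
  have hTc' : D / c' ≤ T := (le_max_right _ _).trans (le_max_right _ _)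
  obtain ⟨C₂, hC₂⟩ := asymp hT1
  -- Comparison with `s = 1` first confines a maximizer to [1/T, T]; only then does the uniform
  -- asymptotic formula apply to it.
  have opt : ∀ r : ℝ, T < r → ∀ s ∈ optimalStretch f L r, s ≤ T ∧
      (latticeCount f L r s : ℝ) ≤
        r ^ 2 * enclosedArea f L - r * L - r * L * (s + 1 / s - 2) / 2 +
          |C₂| * r ^ (2 / 3 : ℝ) := by
    rintro r hr s ⟨hs, hmax⟩
    have hr1 : 1 ≤ r := by linarith
    have hr0 : 0 < r := by linarith
    have h1 : (latticeCount f L r 1 : ℝ) ≤ latticeCount f L r s := by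
      exact_mod_cast hmax 1 one_pos
    have h2 := low' r hr1
    have h3 := hub r s hr0 hs
    have h4 := hub' r s⁻¹ hr0 (inv_pos.2 hs)
    rw [← hΓ.latticeCount_swap hr0 hs] at h4
    have b1 := bound c r s hc hr1 (by linarith) (by linarith)
    have b2 := bound c' r s⁻¹ hc' hr1 (by linarith) (by linarith)
    have b3 : 1 / T ≤ s := by
      rw [one_div]
      exact inv_le_of_inv_le₀ hs (b2.trans hTc')
    have h5 := (abs_le.1 (hC₂ r s hr1 b3 (b1.trans hTc))).2
    have h6 := mul_le_mul_of_nonneg_right (le_abs_self C₂)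
      (Real.rpow_nonneg hr0.le (2 / 3 : ℝ))
    refine ⟨b1.trans hTc, ?_⟩
    rw [show L / s = L * (1 / s) by ring] at h5
    linarith
  constructor
  · refine ⟨√(T * (2 * (|C₁| + |C₂|) / L)), ?_⟩
    filter_upwards [eventually_gt_atTop T] with r hr s hs
    have hr0 : 0 < r := by linarith
    obtain ⟨hsT, hup⟩ := opt r hr s hs
    have h1 : (latticeCount f L r 1 : ℝ) ≤ latticeCount f L r s := by
      exact_mod_cast hs.2 1 one_pos
    have h2 := low r (by linarith)
    have e1 : r ^ (2 / 3 : ℝ) = r * r ^ (-(1 / 3) : ℝ) := by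
      rw [← Real.rpow_one_add' hr0.le (by norm_num)]
      norm_num
    have e2 : r ^ (-(1 / 3) : ℝ) = (r ^ (-(1 / 6) : ℝ)) ^ 2 := by
      rw [← Real.rpow_natCast, ← Real.rpow_mul hr0.le]
      norm_num
    -- The bounds `low` and `hup` squeeze the loss rL(s + 1/s − 2)/2 below (|C₁| + |C₂|)·r^(2/3);
    -- dividing by rL/2 leaves r^(-1/3).
    have hdev : s + 1 / s - 2 ≤ 2 * (|C₁| + |C₂|) / L * r ^ (-(1 / 3) : ℝ) := by
      rw [div_mul_eq_mul_div, le_div_iff₀ hL]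
      refine le_of_mul_le_mul_left ?_ hr0
      rw [e1] at h2 hup
      linarith
    have := abs_sub_one_le_of_add_inv_le hs.1 hsT (by positivity) hdev
    rw [e2, ← mul_assoc, Real.sqrt_mul (by positivity), Real.sqrt_sq (by positivity),
      abs_le] at this
    exact ⟨by linarith [this.1], by linarith [this.2]⟩
  · refine ⟨fun r => sSup (latticeCount f L r '' Ioi 0),
      fun r hr => hΓ.exists_isGreatest_latticeCount hr, ?_⟩
    refine IsBigO.of_bound (|C₁| + |C₂|) ?_
    filter_upwards [eventually_gt_atTop T] with r hr
    have hr0 : 0 < r := by linarith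
    have hgr := hΓ.exists_isGreatest_latticeCount hr0
    obtain ⟨s, hs, hse⟩ := hgr.1
    rw [← hse] at hgr ⊢
    have hs0 : 0 < s := hs
    have hmem : s ∈ optimalStretch f L r :=
      ⟨hs0, fun t ht => hgr.2 (mem_image_of_mem _ (mem_Ioi.2 ht))⟩
    obtain ⟨-, hup⟩ := opt r hr s hmem
    have h1 : (latticeCount f L r 1 : ℝ) ≤ latticeCount f L r s := by
      exact_mod_cast hmem.2 1 one_pos
    have h2 := low r (by linarith)
    -- By AM–GM the loss term is nonnegative and can be dropped from the upper bound; the lower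
    -- bound is the value at `s = 1`.
    have h3 : 0 ≤ s + 1 / s - 2 := by
      have e : s + 1 / s - 2 = (s - 1) ^ 2 / s := by field_simp; ring
      rw [e]
      positivity
    have h4 : 0 ≤ r * L * (s + 1 / s - 2) := by positivity
    have hρ := Real.rpow_nonneg hr0.le (2 / 3 : ℝ)
    have h5 := mul_nonneg (abs_nonneg C₁) hρ
    have h6 := mul_nonneg (abs_nonneg C₂) hρ
    rw [Real.norm_eq_abs, Real.norm_eq_abs, abs_of_nonneg hρ, abs_le]
    constructor <;> linarith
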